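/- For every integer $n \ge 238$ there is a collection $\mathcal{G}_n$ of pairwise non-isomorphic planar graphs on $n$ vertices, each of them a planar 3-tree (a graph obtained from a single triangle by iteratively splitting a facial triangle into three triangles with a new vertex of degree three), such that $\mathcal{G}_n$ contains at least $\frac16 \cdot 7^{(2n-8)/11}$ graphs, and every simultaneously embeddable subcollection of $\mathcal{G}_n$ has at most $(21n+552)\,4^{(n+37)/11}$ members. Here a collection of graphs on $n$ vertices is called simultaneously embeddable if there is a set $X\subset\mathbb{R}^2$ of $n$ points such that every graph in the collection admits a plane straight-line embedding on $X$, that is, can be drawn with distinct vertices at distinct points of $X$ and edges as pairwise non-crossing line segments (the mapping of vertices to points may depend on the graph). In particular, let $\sigma(n)$ be the minimum size of a collection of planar graphs on $n$ vertices that is not simultaneously embeddable. Then $\sigma(n)$ is finite (such a collection exists) for all $n \ge 238$, and $\sigma(n)=O(n\cdot 4^{n/11})$ as $n\to\infty$. -/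

import Mathlib

/-- The Euclidean plane. -/
abbrev Plane : Type := EuclideanSpace ℝ (Fin 2)

/-- A simple graph is planar if it can be drawn in the plane: vertices are represented by distinct
points, every edge by a simple arc joining its two endpoints, an arc contains no vertices other than
its endpoints, and two distinct arcs meet only in common endpoints. -/
def IsPlanar {V : Type*} (G : SimpleGraph V) : Prop :=
  ∃ (p : V → Plane) (arc : Sym2 V → Set Plane),
    Function.Injective p ∧
    (∀ u v : V, G.Adj u v →
      ∃ γ : Path (p u) (p v), Function.Injective γ ∧ Set.range γ = arc s(u, v)) ∧
    (∀ e ∈ G.edgeSet, ∀ v : V, p v ∈ arc e → v ∈ e) ∧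
    (∀ e ∈ G.edgeSet, ∀ f ∈ G.edgeSet, e ≠ f →
      ∀ x ∈ arc e ∩ arc f, ∃ v : V, v ∈ e ∧ v ∈ f ∧ x = p v)

/-- `Stacked S G F`: the graph `G`, supported on the vertex set `S` and with facial triangles `F`
(each given by its set of three vertices), is obtained from a single triangle by iteratively
splitting a facial triangle into three with a new vertex of degree three. A single triangle has two
faces (the inner and the outer one) with the same vertices, hence the multiset. -/
inductive Stacked {V : Type*} [DecidableEq V] :
    Finset V → SimpleGraph V → Multiset (Finset V) → Prop
  | triangle (a b c : V) (hab : a ≠ b) (hac : a ≠ c) (hbc : b ≠ c) :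
      Stacked {a, b, c} (SimpleGraph.fromEdgeSet {s(a, b), s(a, c), s(b, c)})
        {{a, b, c}, {a, b, c}}
  | split (S : Finset V) (G : SimpleGraph V) (F : Multiset (Finset V)) (a b c d : V)
      (h : Stacked S G (({a, b, c} : Finset V) ::ₘ F)) (hd : d ∉ S) :
      Stacked (insert d S) (G ⊔ SimpleGraph.fromEdgeSet {s(a, d), s(b, d), s(c, d)})
        (({a, b, d} : Finset V) ::ₘ ({a, c, d} : Finset V) ::ₘ ({b, c, d} : Finset V) ::ₘ F)

/-- Planar 3-trees, also known as stacked triangulations. -/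
def IsPlanarThreeTree {V : Type*} [Fintype V] [DecidableEq V] (G : SimpleGraph V) : Prop :=
  ∃ F : Multiset (Finset V), Stacked Finset.univ G F

/-- `G` admits a plane straight-line embedding on the point set `X`: distinct vertices are placed at
distinct points of `X`, the segment representing an edge contains no vertices other than its
endpoints, and the open segments representing two distinct edges are disjoint. -/
def StraightLineEmbeddable {V : Type*} (G : SimpleGraph V) (X : Finset Plane) : Prop :=
  ∃ φ : V → Plane,
    Function.Injective φ ∧ (∀ v, φ v ∈ X) ∧
    (∀ u v w : V, G.Adj u v → φ w ∈ segment ℝ (φ u) (φ v) → w = u ∨ w = v) ∧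
    (∀ u v u' v' : V, G.Adj u v → G.Adj u' v' → s(u, v) ≠ s(u', v') →
      Disjoint (openSegment ℝ (φ u) (φ v)) (openSegment ℝ (φ u') (φ v')))

/-- A collection of graphs on `n` vertices is simultaneously embeddable (without mapping) if all its
members admit a straight-line embedding on one common point set of size `n`. -/
def SimultaneouslyEmbeddable {n : ℕ} (𝒢 : Finset (SimpleGraph (Fin n))) : Prop :=
  ∃ X : Finset Plane, X.card = n ∧ ∀ G ∈ 𝒢, StraightLineEmbeddable G X

/-- A conflict collection of planar graphs on `n` vertices. -/
def IsConflictCollection {n : ℕ} (𝒢 : Finset (SimpleGraph (Fin n))) : Prop :=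
  (∀ G ∈ 𝒢, IsPlanar G) ∧ ¬ SimultaneouslyEmbeddable 𝒢

/-- `conflictNumber n` is the minimum size of a conflict collection of planar graphs on `n`
vertices, and `⊤` if there is none. -/
noncomputable def conflictNumber (n : ℕ) : ℕ∞ :=
  ⨅ (𝒢 : Finset (SimpleGraph (Fin n))) (_ : IsConflictCollection 𝒢), (𝒢.card : ℕ∞)

/-! The argument is probabilistic counting. A stacked triangulation on n = N + 4 labelled vertices
is built from K₄ by N splits. With the triangle `v 0, v 1, v 2` kept intact as outer face, the split
numbered k has 2k + 3 faces to choose from, so there are ∏ (2k + 3) choice sequences, roughly 2^N ·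
n! up to polynomial factors.

The geometric core is `eq_of_isDrawing`: a fixed placement φ of the vertices is a plane drawing for
at most one choice sequence. In any plane drawing each face has a region, the side of its triangle
away from a further common neighbour of its corners. This definition does not care which face is
drawn as the outer one. The regions of the faces present at a given stage are disjoint, and a vertex
lies in the region of the face it splits. So if two sequences agree before k, the position of vertex
k + 4 decides which face was chosen at k. Consequently an n-point set carries at most n! choice
sequences, an exponentially small fraction of all of them.

Whether a graph embeds in a point set depends only on incidences and crossings among segments, so at
most 2^(n³ + n⁴) types of point sets matter. By a union bound (`exists_sparse`) there is a sample of
g · m choice sequences of which every type carries fewer than m, where m = 2n⁴. Isomorphic graphs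
embed in the same point sets and every stacked triangulation has a straight-line drawing
(`exists_innerDrawing_stackState`), so every isomorphism class occurs fewer than m times in the
sample. One representative per class leaves at least g graphs. The choice g = ⌊(3/2)^(n-4)⌋ is
affordable because 3/2 < 2.

The stated exponential bounds follow with room to spare: 7^(2/11) ≤ 3/2, and 2n⁴ is below the bound
on embeddable subcollections. Since g ≥ 2n⁴, any 2n⁴ members of the collection conflict. -/

/-! ### Plane geometry: orientations, open triangles, crossing segments -/

/-- Twice the signed area of the triangle `abc`. -/
def orient (a b c : Plane) : ℝ := (b 0 - a 0) * (c 1 - a 1) - (b 1 - a 1) * (c 0 - a 0)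

/-- `p` lies in the open triangle `abc`. -/
def InTri (a b c p : Plane) : Prop :=
  (0 < orient a b p ∧ 0 < orient b c p ∧ 0 < orient c a p) ∨
    (orient a b p < 0 ∧ orient b c p < 0 ∧ orient c a p < 0)

theorem orient_cycle (a b c : Plane) : orient b c a = orient a b c := by
  unfold orient; ring

theorem orient_swap (a b c : Plane) : orient b a c = -orient a b c := by
  unfold orient; ring

theorem orient_swap' (a b c : Plane) : orient a c b = -orient a b c := by
  unfold orient; ring

@[simp] theorem orient_left (a b : Plane) : orient a b a = 0 := by
  unfold orient; ring

@[simp] theorem orient_right (a b : Plane) : orient a b b = 0 := by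
  unfold orient; ring

theorem orient_add (a b c p : Plane) :
    orient a b p + orient b c p + orient c a p = orient a b c := by
  unfold orient; ring

/-- The values `orient b c p`, `orient c a p`, `orient a b p` are the unnormalised barycentric
coordinates of `p`, and `orient u v` is affine in its last argument. -/
theorem orient_barycentric (a b c p u v : Plane) :
    orient b c p * orient u v a + orient c a p * orient u v b + orient a b p * orient u v c
      = orient a b c * orient u v p := by
  unfold orient; ring

theorem InTri.rotate {a b c p : Plane} (h : InTri a b c p) : InTri b c a p := by
  unfold InTri at *; tauto

theorem InTri.swap {a b c p : Plane} (h : InTri a b c p) : InTri b a c p := by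
  unfold InTri at *
  rw [orient_swap a b, orient_swap c a, orient_swap b c]
  rcases h with ⟨h1, h2, h3⟩ | ⟨h1, h2, h3⟩
  · right; refine ⟨?_, ?_, ?_⟩ <;> linarith
  · left; refine ⟨?_, ?_, ?_⟩ <;> linarith

theorem inTri_rotate {a b c p : Plane} : InTri b c a p ↔ InTri a b c p :=
  ⟨fun h => h.rotate.rotate, fun h => h.rotate⟩

theorem inTri_swap {a b c p : Plane} : InTri b a c p ↔ InTri a b c p :=
  ⟨fun h => h.swap, fun h => h.swap⟩

theorem inTri_iff_of_pos {a b c p : Plane} (h : 0 < orient a b c) :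
    InTri a b c p ↔ 0 < orient a b p ∧ 0 < orient b c p ∧ 0 < orient c a p := by
  refine ⟨?_, Or.inl⟩
  rintro (h' | ⟨h1, h2, h3⟩)
  · exact h'
  · have := orient_add a b c p
    linarith

theorem InTri.orient_ne_zero {a b c p : Plane} (h : InTri a b c p) : orient a b c ≠ 0 := by
  have := orient_add a b c p
  intro h0
  rcases h with ⟨h1, h2, h3⟩ | ⟨h1, h2, h3⟩ <;> linarith

/-- An affine functional that is nonnegative at the corners of a triangle, and not zero at all of
them, is positive inside. -/
theorem InTri.orient_pos {a b c p u v : Plane} (h : InTri a b c p) (ha : 0 ≤ orient u v a)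
    (hb : 0 ≤ orient u v b) (hc : 0 ≤ orient u v c)
    (hs : 0 < orient u v a ∨ 0 < orient u v b ∨ 0 < orient u v c) : 0 < orient u v p := by
  have key := orient_barycentric a b c p u v
  have hadd := orient_add a b c p
  rcases h with ⟨h1, h2, h3⟩ | ⟨h1, h2, h3⟩
  · have hD : 0 < orient a b c := by linarith
    refine pos_of_mul_pos_right (a := orient a b c) ?_ hD.le
    rw [← key]
    rcases hs with hs | hs | hs
    · have := mul_pos h2 hs
      have := mul_nonneg h3.le hb
      have := mul_nonneg h1.le hc
      linarith
    · have := mul_nonneg h2.le ha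
      have := mul_pos h3 hs
      have := mul_nonneg h1.le hc
      linarith
    · have := mul_nonneg h2.le ha
      have := mul_nonneg h3.le hb
      have := mul_pos h1 hs
      linarith
  · have hD : orient a b c < 0 := by linarith
    refine (neg_iff_pos_of_mul_neg (a := orient a b c) ?_).1 hD
    rw [← key]
    rcases hs with hs | hs | hs
    · have := mul_neg_of_neg_of_pos h2 hs
      have := mul_nonpos_of_nonpos_of_nonneg h3.le hb
      have := mul_nonpos_of_nonpos_of_nonneg h1.le hc
      linarith
    · have := mul_nonpos_of_nonpos_of_nonneg h2.le ha
      have := mul_neg_of_neg_of_pos h3 hs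
      have := mul_nonpos_of_nonpos_of_nonneg h1.le hc
      linarith
    · have := mul_nonpos_of_nonpos_of_nonneg h2.le ha
      have := mul_nonpos_of_nonpos_of_nonneg h3.le hb
      have := mul_neg_of_neg_of_pos h1 hs
      linarith

theorem InTri.orient_neg {a b c p u v : Plane} (h : InTri a b c p) (ha : orient u v a ≤ 0)
    (hb : orient u v b ≤ 0) (hc : orient u v c ≤ 0)
    (hs : orient u v a < 0 ∨ orient u v b < 0 ∨ orient u v c < 0) : orient u v p < 0 := by
  have := h.orient_pos (u := v) (v := u) (by rw [orient_swap]; linarith)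
    (by rw [orient_swap]; linarith) (by rw [orient_swap]; linarith)
    (by simpa only [orient_swap u v, neg_pos] using hs)
  rw [orient_swap] at this
  linarith

/-- A triangle cut off by an interior point and an edge is contained in the triangle. -/
theorem InTri.trans {a b c x y : Plane} (hx : InTri a b c x) (hy : InTri a b x y) :
    InTri a b c y := by
  have h0 := orient_add a b c x
  have e1 := orient_cycle a b c
  have e2 := orient_cycle b c a
  rcases hx with ⟨h1, h2, h3⟩ | ⟨h1, h2, h3⟩
  · refine Or.inl ⟨hy.orient_pos ?_ ?_ ?_ ?_, hy.orient_pos ?_ ?_ ?_ ?_,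
      hy.orient_pos ?_ ?_ ?_ ?_⟩ <;> (try simp only [orient_left, orient_right]) <;>
      first | linarith | exact Or.inl (by linarith) | exact Or.inr (Or.inl (by linarith)) |
        exact Or.inr (Or.inr (by linarith))
  · refine Or.inr ⟨hy.orient_neg ?_ ?_ ?_ ?_, hy.orient_neg ?_ ?_ ?_ ?_,
      hy.orient_neg ?_ ?_ ?_ ?_⟩ <;> (try simp only [orient_left, orient_right]) <;>
      first | linarith | exact Or.inl (by linarith) | exact Or.inr (Or.inl (by linarith)) |
        exact Or.inr (Or.inr (by linarith))

/-- Two triangles cut off by an interior point do not overlap. -/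
theorem InTri.not_inTri_of_inTri {a b c x y : Plane} (hx : InTri a b c x) (hy : InTri a b x y) :
    ¬ InTri b c x y := by
  intro hz
  have e1 := orient_cycle b x c
  have e2 := orient_cycle a b x
  have e3 := orient_swap b x y
  have e4 := orient_swap' b x a
  have e5 := orient_swap' b c x
  rcases hx with ⟨h1, h2, h3⟩ | ⟨h1, h2, h3⟩
  · have := hy.orient_pos (u := b) (v := x) (by linarith) (by simp) (by simp) (Or.inl (by linarith))
    have := hz.orient_neg (u := b) (v := x) (by simp) (by linarith) (by simp)
      (Or.inr (Or.inl (by linarith)))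
    linarith
  · have := hy.orient_neg (u := b) (v := x) (by linarith) (by simp) (by simp) (Or.inl (by linarith))
    have := hz.orient_pos (u := b) (v := x) (by simp) (by linarith) (by simp)
      (Or.inr (Or.inl (by linarith)))
    linarith

theorem not_inTri_left {a b c : Plane} : ¬ InTri a b c a := by
  simp [InTri]

theorem not_inTri_right {a b c : Plane} : ¬ InTri a b c c := by
  simp [InTri]

theorem not_inTri_mid {a b c : Plane} : ¬ InTri a b c b := by
  simp [InTri]

/-- A corner of a triangle does not lie in a triangle cut off by an interior point. -/
theorem InTri.not_inTri_corner {a b c x : Plane} (hx : InTri a b c x) : ¬ InTri a b x c :=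
  fun h => not_inTri_right (hx.trans h)

/-- The weights are the barycentric coordinates of `p`; the one belonging to `c` vanishes. -/
theorem mem_segment_of_orient {a b c p : Plane} (h : 0 < orient a b c) (h0 : orient a b p = 0)
    (h1 : 0 ≤ orient b c p) (h2 : 0 ≤ orient c a p) : p ∈ segment ℝ a b := by
  have hadd := orient_add a b c p
  refine ⟨orient b c p / orient a b c, orient c a p / orient a b c, by positivity, by positivity,
    ?_, ?_⟩
  · field_simp; linarith
  · have hi : ∀ i : Fin 2, orient b c p * a i + orient c a p * b i + orient a b p * c i
        = orient a b c * p i := by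
      intro i; fin_cases i <;> simp [orient] <;> ring
    ext i
    have := hi i
    simp only [PiLp.add_apply, PiLp.smul_apply, smul_eq_mul]
    field_simp
    rw [h0] at this
    linarith

/-- The position of `y` relative to the three triangles into which `x` splits a triangle. -/
theorem InTri.split {u v w x y : Plane} (hx : InTri u v w x) (hy : InTri u v w y) :
    InTri x u v y ∨ InTri x v w y ∨ InTri x w u y ∨
      y ∈ segment ℝ x u ∨ y ∈ segment ℝ x v ∨ y ∈ segment ℝ x w := by
  wlog h : 0 < orient u v w generalizing u v w
  · have h' : 0 < orient v u w := by
      rw [orient_swap]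
      have := hx.orient_ne_zero
      rcases this.lt_or_gt with h' | h' <;> linarith
    have := this hx.swap hy.swap h'
    have r1 : InTri x v u y → InTri x u v y := fun h => h.rotate.swap.rotate.rotate
    have r2 : InTri x u w y → InTri x w u y := fun h => h.rotate.swap.rotate.rotate
    have r3 : InTri x w v y → InTri x v w y := fun h => h.rotate.swap.rotate.rotate
    tauto
  rw [inTri_iff_of_pos h] at hx hy
  obtain ⟨hx1, hx2, hx3⟩ := hx
  obtain ⟨hy1, hy2, hy3⟩ := hy
  -- Positive barycentric weights of `x` make the three spoke orientations of `y` balance to zero.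
  -- Hence going around the spokes there is a change from positive to negative, which places `y` in
  -- that sector, or else `y` lies on a spoke.
  have key : orient v w x * orient x u y + orient w u x * orient x v y + orient u v x * orient x w y
      = 0 := by unfold orient; ring
  have a1 := orient_swap x u y
  have a2 := orient_swap x v y
  have a3 := orient_swap x w y
  have b1 := orient_cycle x u v
  have b2 := orient_cycle x v w
  have b3 := orient_cycle x w u
  by_cases c1 : 0 < orient x u y ∧ orient x v y < 0
  · exact Or.inl (Or.inl ⟨c1.1, hy1, by linarith⟩)
  by_cases c2 : 0 < orient x v y ∧ orient x w y < 0
  · exact Or.inr (Or.inl (Or.inl ⟨c2.1, hy2, by linarith⟩))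
  by_cases c3 : 0 < orient x w y ∧ orient x u y < 0
  · exact Or.inr (Or.inr (Or.inl (Or.inl ⟨c3.1, hy3, by linarith⟩)))
  have z1 : orient x u y = 0 → orient x v y ≤ 0 → y ∈ segment ℝ x u := fun h1 h2 =>
    mem_segment_of_orient (c := v) (by linarith) h1 hy1.le (by linarith)
  have z2 : orient x v y = 0 → orient x w y ≤ 0 → y ∈ segment ℝ x v := fun h1 h2 =>
    mem_segment_of_orient (c := w) (by linarith) h1 hy2.le (by linarith)
  have z3 : orient x w y = 0 → orient x u y ≤ 0 → y ∈ segment ℝ x w := fun h1 h2 =>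
    mem_segment_of_orient (c := u) (by linarith) h1 hy3.le (by linarith)
  push Not at c1 c2 c3
  rcases lt_trichotomy (orient x u y) 0 with p1 | p1 | p1
  · have m1 := mul_neg_of_pos_of_neg hx2 p1
    rcases lt_trichotomy (orient x w y) 0 with p3 | p3 | p3
    · have m3 := mul_neg_of_pos_of_neg hx1 p3
      have m2 : 0 < orient x v y := pos_of_mul_pos_right (a := orient w u x) (by linarith) hx3.le
      exact absurd (c2 m2) (by linarith)
    · exact Or.inr (Or.inr (Or.inr (Or.inr (Or.inr (z3 p3 p1.le)))))
    · exact absurd (c3 p3) (by linarith)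
  · rcases le_or_gt (orient x v y) 0 with p2 | p2
    · exact Or.inr (Or.inr (Or.inr (Or.inl (z1 p1 p2))))
    · have m2 := mul_pos hx3 p2
      have m3 := mul_nonneg hx1.le (c2 p2)
      rw [p1] at key
      linarith
  · have m1 := mul_pos hx2 p1
    rcases (c1 p1).eq_or_lt with p2 | p2
    · rcases le_or_gt (orient x w y) 0 with p3 | p3
      · exact Or.inr (Or.inr (Or.inr (Or.inr (Or.inl (z2 p2.symm p3)))))
      · have m3 := mul_pos hx1 p3
        rw [← p2] at key
        linarith
    · have m2 := mul_pos hx3 p2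
      have m3 := mul_nonneg hx1.le (c2 p2)
      linarith

/-- A segment that starts inside a triangle and does not meet its sides ends inside. -/
theorem InTri.of_disjoint {a b c p q : Plane} (hp : InTri a b c p)
    (hab : Disjoint (segment ℝ p q) (segment ℝ a b))
    (hbc : Disjoint (segment ℝ p q) (segment ℝ b c))
    (hca : Disjoint (segment ℝ p q) (segment ℝ c a)) : InTri a b c q := by
  wlog h : 0 < orient a b c generalizing a b
  · have h' : 0 < orient b a c := by
      rw [orient_swap]
      have := hp.orient_ne_zero
      rcases this.lt_or_gt with h' | h' <;> linarith
    exact (this hp.swap (by rwa [segment_symm ℝ b a]) (by rwa [segment_symm ℝ a c])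
      (by rwa [segment_symm ℝ c b]) h').swap
  rw [inTri_iff_of_pos h] at hp ⊢
  by_contra hq
  let x : ℝ → Plane := fun t => (1 - t) • p + t • q
  have hx : ∀ u v t, orient u v (x t) = (1 - t) * orient u v p + t * orient u v q := by
    intro u v t; simp [x, orient]; ring
  -- The minimum of the three side functionals is positive exactly inside the triangle; at a zero of
  -- it the moving point lies on a side.
  let g : ℝ → ℝ := fun t => min (orient a b (x t)) (min (orient b c (x t)) (orient c a (x t)))
  have hg : Continuous g := by
    simp only [g, hx]; fun_prop
  have h0 : 0 ≤ g 0 := by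
    simp only [g, hx]; simp [hp.1.le, hp.2.1.le, hp.2.2.le]
  have h1 : g 1 ≤ 0 := by
    by_contra h1
    simp only [g, hx] at h1
    simp at h1
    tauto
  obtain ⟨t, ht, hgt⟩ := intermediate_value_Icc' (zero_le_one' ℝ) hg.continuousOn ⟨h1, h0⟩
  have hxs : x t ∈ segment ℝ p q := ⟨1 - t, t, by linarith [ht.2], ht.1, by ring, rfl⟩
  have g1 : 0 ≤ orient a b (x t) := hgt.symm.le.trans (min_le_left _ _)
  have g2 : 0 ≤ orient b c (x t) :=
    hgt.symm.le.trans ((min_le_right _ _).trans (min_le_left _ _))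
  have g3 : 0 ≤ orient c a (x t) :=
    hgt.symm.le.trans ((min_le_right _ _).trans (min_le_right _ _))
  have : orient a b (x t) = 0 ∨ orient b c (x t) = 0 ∨ orient c a (x t) = 0 := by
    by_contra hne
    push Not at hne
    have : 0 < g t := lt_min (lt_of_le_of_ne g1 hne.1.symm)
      (lt_min (lt_of_le_of_ne g2 hne.2.1.symm) (lt_of_le_of_ne g3 hne.2.2.symm))
    linarith
  have e1 := orient_cycle a b c
  have e2 := orient_cycle b c a
  rcases this with h' | h' | h'
  · exact Set.disjoint_left.1 hab hxs (mem_segment_of_orient h h' g2 g3)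
  · exact Set.disjoint_left.1 hbc hxs (mem_segment_of_orient (c := a) (by linarith) h' g3 g1)
  · exact Set.disjoint_left.1 hca hxs (mem_segment_of_orient (c := b) (by linarith) h' g1 g2)

theorem not_disjoint_segment_of_orient {a b c d : Plane}
    (h1 : orient a b c * orient a b d < 0) (h2 : orient c d a * orient c d b < 0) :
    ¬ Disjoint (segment ℝ a b) (segment ℝ c d) := by
  have weights : ∀ x y : ℝ, x * y < 0 → x - y ≠ 0 ∧ 0 ≤ x / (x - y) ∧ 0 ≤ -y / (x - y) := by
    intro x y h
    rcases mul_neg_iff.1 h with ⟨hx, hy⟩ | ⟨hx, hy⟩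
    · exact ⟨by linarith, div_nonneg hx.le (by linarith), div_nonneg (by linarith) (by linarith)⟩
    · exact ⟨by linarith, div_nonneg_of_nonpos hx.le (by linarith),
        div_nonneg_of_nonpos (by linarith) (by linarith)⟩
  obtain ⟨n1, p1, q1⟩ := weights _ _ h1
  obtain ⟨n2, p2, q2⟩ := weights _ _ h2
  have hrel : orient c d a - orient c d b = orient a b d - orient a b c := by
    unfold orient; ring
  rw [Set.not_disjoint_iff]
  -- The intersection point of the two lines: along `a b` the functional `orient c d` vanishes
  -- there, along `c d` the functional `orient a b` does.
  refine ⟨(-orient c d b / (orient c d a - orient c d b)) • a +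
      (orient c d a / (orient c d a - orient c d b)) • b, ⟨_, _, q2, p2, ?_, rfl⟩,
    ⟨-orient a b d / (orient a b c - orient a b d),
      orient a b c / (orient a b c - orient a b d), q1, p1, ?_, ?_⟩⟩
  · field_simp; ring
  · field_simp; ring
  · have n3 : orient a b d - orient a b c ≠ 0 := fun h => n1 (by linarith)
    rw [hrel]
    have hi : ∀ i : Fin 2, orient a b d * c i - orient a b c * d i =
        -orient c d b * a i + orient c d a * b i := by
      intro i; fin_cases i <;> simp [orient] <;> ring
    ext i
    have := hi i
    simp only [PiLp.add_apply, PiLp.smul_apply, smul_eq_mul]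
    rw [← neg_sub (orient a b d) (orient a b c)]
    field_simp
    linarith

/-- In a straight-line drawing of `K₄` one vertex lies inside the triangle of the others. -/
theorem exists_inTri_of_disjoint {a b c d : Plane} (habc : orient a b c ≠ 0)
    (habd : orient a b d ≠ 0) (hacd : orient a c d ≠ 0) (hbcd : orient b c d ≠ 0)
    (h1 : Disjoint (segment ℝ a b) (segment ℝ c d))
    (h2 : Disjoint (segment ℝ a c) (segment ℝ b d))
    (h3 : Disjoint (segment ℝ a d) (segment ℝ b c)) :
    InTri b c d a ∨ InTri a c d b ∨ InTri a b d c ∨ InTri a b c d := by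
  have k1 : ¬ (orient a b c * orient a b d < 0 ∧ orient c d a * orient c d b < 0) :=
    fun h => not_disjoint_segment_of_orient h.1 h.2 h1
  have k2 : ¬ (orient a c b * orient a c d < 0 ∧ orient b d a * orient b d c < 0) :=
    fun h => not_disjoint_segment_of_orient h.1 h.2 h2
  have k3 : ¬ (orient a d b * orient a d c < 0 ∧ orient b c a * orient b c d < 0) :=
    fun h => not_disjoint_segment_of_orient h.1 h.2 h3
  have hsum : orient a b c - orient a b d + orient a c d - orient b c d = 0 := by
    unfold orient; ring
  have e1 : orient c d a = orient a c d := orient_cycle a c d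
  have e2 : orient c d b = orient b c d := orient_cycle b c d
  have e3 : orient b d a = orient a b d := orient_cycle a b d
  have e4 : orient b c a = orient a b c := orient_cycle a b c
  have e5 : orient d b a = -orient a b d := by rw [orient_swap, e3]
  have e6 : orient d a b = orient a b d := by rw [orient_swap', e5, neg_neg]
  have e7 : orient d a c = orient a c d := by rw [← orient_cycle d a c]
  have e8 : orient c a d = -orient a c d := orient_swap a c d
  simp only [e1, e2, e3, e4, orient_swap' a b c, orient_swap' b c d, orient_swap' a b d,
    orient_swap' a c d] at k1 k2 k3
  simp only [InTri, e1, e2, e4, e5, e6, e7, e8, orient_swap' a b c, orient_swap' b c d]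
  generalize orient a b c = p at *
  generalize orient a b d = q at *
  generalize orient a c d = r at *
  generalize orient b c d = s at *
  simp only [mul_neg_iff, neg_pos, neg_neg_iff_pos] at *
  -- Of the 16 sign patterns, `hsum` excludes two, six are convex positions in which two opposite
  -- edges cross, and the remaining eight are the four nested positions in both orientations.
  rcases habc.lt_or_gt with h1 | h1 <;> rcases habd.lt_or_gt with h2 | h2 <;>
  rcases hacd.lt_or_gt with h3 | h3 <;> rcases hbcd.lt_or_gt with h4 | h4 <;>
  first | (exfalso; linarith) | simp [h1, h2, h3, h4, h1.le, h2.le, h3.le, h4.le] at k1 k2 k3 ⊢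

/-! ### Plane drawings: triangles separate the common neighbours of their corners -/

/-- `φ` places the vertices of `G` such that the straight-line drawing is plane. -/
def IsDrawing {V : Type*} (G : SimpleGraph V) (φ : V → Plane) : Prop :=
  Function.Injective φ ∧
    (∀ u v w : V, G.Adj u v → φ w ∈ segment ℝ (φ u) (φ v) → w = u ∨ w = v) ∧
    (∀ u v u' v' : V, G.Adj u v → G.Adj u' v' → s(u, v) ≠ s(u', v') →
      Disjoint (openSegment ℝ (φ u) (φ v)) (openSegment ℝ (φ u') (φ v')))

/-- The vertices `a`, `b`, `c`, `d` are pairwise adjacent. -/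
def IsTetra {V : Type*} (G : SimpleGraph V) (a b c d : V) : Prop :=
  G.Adj a b ∧ G.Adj a c ∧ G.Adj a d ∧ G.Adj b c ∧ G.Adj b d ∧ G.Adj c d

theorem IsTetra.rotate {V : Type*} {G : SimpleGraph V} {a b c d : V} (h : IsTetra G a b c d) :
    IsTetra G b c a d :=
  ⟨h.2.2.2.1, h.1.symm, h.2.2.2.2.1, h.2.1.symm, h.2.2.2.2.2, h.2.2.1⟩

theorem IsTetra.swap {V : Type*} {G : SimpleGraph V} {a b c d : V} (h : IsTetra G a b c d) :
    IsTetra G b a c d :=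
  ⟨h.1.symm, h.2.2.2.1, h.2.2.2.2.1, h.2.1, h.2.2.1, h.2.2.2.2.2⟩

theorem IsTetra.swap_last {V : Type*} {G : SimpleGraph V} {a b c d : V} (h : IsTetra G a b c d) :
    IsTetra G a b d c :=
  ⟨h.1, h.2.2.1, h.2.1, h.2.2.2.2.1, h.2.2.2.1, h.2.2.2.2.2.symm⟩

theorem IsTetra.mono {V : Type*} {G H : SimpleGraph V} (hGH : G ≤ H) {a b c d : V}
    (h : IsTetra G a b c d) : IsTetra H a b c d :=
  ⟨hGH h.1, hGH h.2.1, hGH h.2.2.1, hGH h.2.2.2.1, hGH h.2.2.2.2.1, hGH h.2.2.2.2.2⟩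

/-- Of three collinear points one is between the others. In a drawing this would put a vertex on an
edge, so every triangle of the graph is drawn nondegenerate. -/
theorem exists_mem_segment_of_orient_eq_zero {a b c : Plane} (h : orient a b c = 0) :
    a ∈ segment ℝ b c ∨ b ∈ segment ℝ a c ∨ c ∈ segment ℝ a b := by
  have hcol : Collinear ℝ {a, b, c} := by
    rw [collinear_iff_of_mem (p₀ := a) (by simp)]
    by_cases hab : a = b
    · refine ⟨c -ᵥ a, ?_⟩
      simp only [Set.mem_insert_iff, Set.mem_singleton_iff, forall_eq_or_imp, forall_eq]
      exact ⟨⟨0, by simp⟩, ⟨0, by simp [hab]⟩, ⟨1, by simp⟩⟩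
    · refine ⟨b -ᵥ a, ?_⟩
      simp only [Set.mem_insert_iff, Set.mem_singleton_iff, forall_eq_or_imp, forall_eq]
      refine ⟨⟨0, by simp⟩, ⟨1, by simp⟩, ?_⟩
      unfold orient at h
      by_cases h0 : b 0 - a 0 = 0
      · have h1 : b 1 - a 1 ≠ 0 := by
          intro h1
          apply hab
          ext i
          fin_cases i
          · simpa using (sub_eq_zero.1 h0).symm
          · simpa using (sub_eq_zero.1 h1).symm
        refine ⟨(c 1 - a 1) / (b 1 - a 1), ?_⟩
        ext i
        fin_cases i
        · simp only [Fin.zero_eta, vsub_eq_sub, vadd_eq_add, PiLp.add_apply, PiLp.smul_apply,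
            PiLp.sub_apply, smul_eq_mul]
          field_simp
          linarith
        · simp only [Fin.mk_one, vsub_eq_sub, vadd_eq_add, PiLp.add_apply, PiLp.smul_apply,
            PiLp.sub_apply, smul_eq_mul]
          field_simp
          ring
      · refine ⟨(c 0 - a 0) / (b 0 - a 0), ?_⟩
        ext i
        fin_cases i
        · simp only [Fin.zero_eta, vsub_eq_sub, vadd_eq_add, PiLp.add_apply, PiLp.smul_apply,
            PiLp.sub_apply, smul_eq_mul]
          field_simp
          ring
        · simp only [Fin.mk_one, vsub_eq_sub, vadd_eq_add, PiLp.add_apply, PiLp.smul_apply,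
            PiLp.sub_apply, smul_eq_mul]
          field_simp
          linarith
  rcases hcol.wbtw_or_wbtw_or_wbtw with h | h | h
  · exact Or.inr (Or.inl (mem_segment_iff_wbtw.2 h))
  · exact Or.inr (Or.inr (by rw [segment_symm]; exact mem_segment_iff_wbtw.2 h))
  · exact Or.inl (by rw [segment_symm]; exact mem_segment_iff_wbtw.2 h)

namespace IsDrawing

variable {V : Type*} {G : SimpleGraph V} {φ : V → Plane}

theorem notMem_segment (h : IsDrawing G φ) {u v w : V} (huv : G.Adj u v) (hu : w ≠ u)
    (hv : w ≠ v) : φ w ∉ segment ℝ (φ u) (φ v) := fun hw =>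
  (h.2.1 u v w huv hw).elim hu hv

theorem disjoint_segment (h : IsDrawing G φ) {u v u' v' : V} (h1 : G.Adj u v) (h2 : G.Adj u' v')
    (h3 : u ≠ u') (h4 : u ≠ v') (h5 : v ≠ u') (h6 : v ≠ v') :
    Disjoint (segment ℝ (φ u) (φ v)) (segment ℝ (φ u') (φ v')) := by
  have ho := h.2.2 u v u' v' h1 h2 (by simp; tauto)
  rw [← insert_endpoints_openSegment ℝ (φ u), ← insert_endpoints_openSegment ℝ (φ u')]
  have a1 := h.notMem_segment h2 h3 h4
  have a2 := h.notMem_segment h2 h5 h6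
  have a3 := h.notMem_segment h1 h3.symm h5.symm
  have a4 := h.notMem_segment h1 h4.symm h6.symm
  rw [← insert_endpoints_openSegment ℝ] at a1 a2 a3 a4
  simp only [Set.mem_insert_iff, not_or] at a1 a2 a3 a4
  simp only [Set.disjoint_insert_left, Set.disjoint_insert_right, Set.mem_insert_iff, not_or]
  exact ⟨a3, a4, a1.2.2, a2.2.2, ho⟩

theorem orient_ne_zero (h : IsDrawing G φ) {a b c : V} (hab : G.Adj a b) (hac : G.Adj a c)
    (hbc : G.Adj b c) : orient (φ a) (φ b) (φ c) ≠ 0 := by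
  intro h0
  rcases exists_mem_segment_of_orient_eq_zero h0 with h' | h' | h'
  · exact h.notMem_segment hbc hab.ne hac.ne h'
  · exact h.notMem_segment hac hab.ne.symm hbc.ne h'
  · exact h.notMem_segment hab hac.ne.symm hbc.ne.symm h'

/-- An edge disjoint from a triangle of the graph cannot cross its sides. This is the tool for
dragging neighbours into a triangle. -/
theorem inTri_of_adj (h : IsDrawing G φ) {a b c p q : V} (hab : G.Adj a b) (hac : G.Adj a c)
    (hbc : G.Adj b c) (hpq : G.Adj p q) (hpa : p ≠ a) (hpb : p ≠ b) (hpc : p ≠ c) (hqa : q ≠ a)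
    (hqb : q ≠ b) (hqc : q ≠ c) (hp : InTri (φ a) (φ b) (φ c) (φ p)) :
    InTri (φ a) (φ b) (φ c) (φ q) :=
  hp.of_disjoint (h.disjoint_segment hpq hab hpa hpb hqa hqb)
    (h.disjoint_segment hpq hbc hpb hpc hqb hqc)
    (h.disjoint_segment hpq hac.symm hpc hpa hqc hqa)

theorem inTri_of_isTetra (h : IsDrawing G φ) {a b c d : V} (ht : IsTetra G a b c d) :
    InTri (φ b) (φ c) (φ d) (φ a) ∨ InTri (φ a) (φ c) (φ d) (φ b) ∨
      InTri (φ a) (φ b) (φ d) (φ c) ∨ InTri (φ a) (φ b) (φ c) (φ d) := by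
  obtain ⟨hab, hac, had, hbc, hbd, hcd⟩ := ht
  exact exists_inTri_of_disjoint (h.orient_ne_zero hab hac hbc) (h.orient_ne_zero hab had hbd)
    (h.orient_ne_zero hac had hcd) (h.orient_ne_zero hbc hbd hcd)
    (h.disjoint_segment hab hcd hac.ne had.ne hbc.ne hbd.ne)
    (h.disjoint_segment hac hbd hab.ne had.ne hbc.ne.symm hcd.ne)
    (h.disjoint_segment had hbc hab.ne hac.ne hbd.ne.symm hcd.ne.symm)

/-- Two further common neighbours of the vertices of a triangle cannot both lie inside it. -/
theorem not_inTri_of_inTri (h : IsDrawing G φ) {a b c p q : V} (hp : IsTetra G a b c p)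
    (hq : IsTetra G a b c q) (hpq : p ≠ q) (hpin : InTri (φ a) (φ b) (φ c) (φ p)) :
    ¬ InTri (φ a) (φ b) (φ c) (φ q) := by
  intro hqin
  obtain ⟨hab, hac, hap, hbc, hbp, hcp⟩ := hp
  obtain ⟨-, -, haq, -, hbq, hcq⟩ := hq
  -- Whichever of the three parts around `p` contains `q`, the third corner is adjacent to `q` and
  -- would be dragged into that part, although it is a corner of the surrounding triangle.
  rcases hpin.split hqin with h' | h' | h' | h' | h' | h'
  · exact hpin.not_inTri_corner (h.inTri_of_adj hap.symm hbp.symm hab hcq.symm hpq.symm haq.ne.symm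
      hbq.ne.symm hcp.ne hac.ne.symm hbc.ne.symm h').rotate
  · exact hpin.rotate.not_inTri_corner (h.inTri_of_adj hbp.symm hcp.symm hbc haq.symm hpq.symm
      hbq.ne.symm hcq.ne.symm hap.ne hab.ne hac.ne h').rotate
  · exact hpin.rotate.rotate.not_inTri_corner (h.inTri_of_adj hcp.symm hap.symm hac.symm hbq.symm
      hpq.symm hcq.ne.symm haq.ne.symm hbp.ne hbc.ne hab.ne.symm h').rotate
  · exact h.notMem_segment hap.symm hpq.symm haq.ne.symm h'
  · exact h.notMem_segment hbp.symm hpq.symm hbq.ne.symm h'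
  · exact h.notMem_segment hcp.symm hpq.symm hcq.ne.symm h'

/-- With `a` innermost, the edge `a q` drags `q` into the triangle `b c p`, which `a` splits into
three. In either part other than `a b c`, a neighbour `b` or `c` of `q` would be dragged along, but
these are outer corners. -/
theorem inTri_of_inTri_outer (h : IsDrawing G φ) {a b c p q : V} (hp : IsTetra G a b c p)
    (hq : IsTetra G a b c q) (hpq : p ≠ q) (hain : InTri (φ b) (φ c) (φ p) (φ a)) :
    InTri (φ a) (φ b) (φ c) (φ q) := by
  obtain ⟨hab, hac, hap, hbc, hbp, hcp⟩ := hp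
  obtain ⟨-, -, haq, -, hbq, hcq⟩ := hq
  have hqin : InTri (φ b) (φ c) (φ p) (φ q) := h.inTri_of_adj hbc hbp hcp haq hab.ne hac.ne hap.ne
    hbq.ne.symm hcq.ne.symm hpq.symm hain
  rcases hain.split hqin with h' | h' | h' | h' | h' | h'
  · exact h'
  · exact absurd (h.inTri_of_adj hac hap hcp hbq.symm haq.ne.symm hcq.ne.symm hpq.symm hab.ne.symm
      hbc.ne hbp.ne h').rotate hain.rotate.not_inTri_corner
  · exact absurd (h.inTri_of_adj hap hab hbp.symm hcq.symm haq.ne.symm hpq.symm hbq.ne.symm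
      hac.ne.symm hcp.ne hbc.ne.symm h').rotate hain.rotate.rotate.not_inTri_corner
  · exact absurd h' (h.notMem_segment hab haq.ne.symm hbq.ne.symm)
  · exact absurd h' (h.notMem_segment hac haq.ne.symm hcq.ne.symm)
  · exact absurd h' (h.notMem_segment hap haq.ne.symm hpq.symm)

/-- A triangle separates any two further common neighbours of its vertices. -/
theorem xor_inTri (h : IsDrawing G φ) {a b c p q : V} (hp : IsTetra G a b c p)
    (hq : IsTetra G a b c q) (hpq : p ≠ q) :
    Xor (InTri (φ a) (φ b) (φ c) (φ p)) (InTri (φ a) (φ b) (φ c) (φ q)) := by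
  by_cases hpin : InTri (φ a) (φ b) (φ c) (φ p)
  · exact Or.inl ⟨hpin, h.not_inTri_of_inTri hp hq hpq hpin⟩
  · refine Or.inr ⟨?_, hpin⟩
    rcases h.inTri_of_isTetra hp with h' | h' | h' | h'
    · exact h.inTri_of_inTri_outer hp hq hpq h'
    · exact (h.inTri_of_inTri_outer hp.swap hq.swap hpq h').swap
    · exact (h.inTri_of_inTri_outer hp.rotate.rotate hq.rotate.rotate hpq h').rotate
    · exact absurd h' hpin

end IsDrawing

/-! ### Regions of faces -/

/-- The side of the triangle `abc` that does not contain `o`. -/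
def farSide (a b c o : Plane) : Set Plane := {x | Xor (InTri a b c x) (InTri a b c o)}

theorem farSide_rotate (a b c o : Plane) : farSide b c a o = farSide a b c o := by
  simp only [farSide, inTri_rotate]

theorem farSide_swap (a b c o : Plane) : farSide b a c o = farSide a b c o := by
  simp only [farSide, inTri_swap]

namespace IsDrawing

variable {V : Type*} {G : SimpleGraph V} {φ : V → Plane}

/-- The faces of a straight-line drawing of `K₄` are disjoint. -/
theorem disjoint_farSide (h : IsDrawing G φ) {a b c d : V} (ht : IsTetra G a b c d) :
    Disjoint (farSide (φ a) (φ b) (φ d) (φ c)) (farSide (φ b) (φ c) (φ d) (φ a)) := by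
  rw [Set.disjoint_left]
  rintro x hx hx'
  -- The cases name the innermost vertex. If it is `a` or `c`, one of the two regions is the
  -- exterior of the outer triangle; if it is `b` or `d`, both are inner triangles.
  rcases h.inTri_of_isTetra ht with h' | h' | h' | h'
  · have n1 : ¬ InTri (φ a) (φ b) (φ d) (φ c) := fun h2 =>
      h'.rotate.rotate.not_inTri_corner h2.swap.rotate.rotate
    have n2 := hx.elim (fun h => h.1) (fun h => absurd h.1 n1)
    have n3 := hx'.elim (fun h => absurd h' h.2) (fun h => h.2)
    exact n3 (h'.rotate.rotate.trans n2.swap.rotate.rotate).rotate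
  · have n1 : ¬ InTri (φ a) (φ b) (φ d) (φ c) := fun h2 =>
      h'.rotate.rotate.not_inTri_corner h2.rotate.rotate
    have n2 : ¬ InTri (φ b) (φ c) (φ d) (φ a) := fun h2 =>
      h'.rotate.not_inTri_corner h2.rotate
    have n3 := hx.elim (fun h => h.1) (fun h => absurd h.1 n1)
    have n4 := hx'.elim (fun h => h.1) (fun h => absurd h.1 n2)
    exact h'.swap.rotate.not_inTri_of_inTri n3.swap.rotate n4.rotate.swap
  · have n1 : ¬ InTri (φ b) (φ c) (φ d) (φ a) := fun h2 =>
      h'.rotate.not_inTri_corner h2.swap.rotate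
    have n2 := hx'.elim (fun h => h.1) (fun h => absurd h.1 n1)
    have n3 := hx.elim (fun h => absurd h' h.2) (fun h => h.2)
    exact n3 (h'.rotate.trans n2.swap.rotate).rotate.rotate
  · have n1 : ¬ InTri (φ a) (φ b) (φ d) (φ c) := h'.not_inTri_corner
    have n2 : ¬ InTri (φ b) (φ c) (φ d) (φ a) := h'.rotate.not_inTri_corner
    have n3 := hx.elim (fun h => h.1) (fun h => absurd h.1 n1)
    have n4 := hx'.elim (fun h => h.1) (fun h => absurd h.1 n2)
    exact h'.not_inTri_of_inTri n3 n4

/-- Splitting a face refines its region: `d` lies on the side of `a b c` away from `o`, and so do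
the new faces at `d`. Both the inner and the outer position of the split face occur. -/
theorem farSide_subset (h : IsDrawing G φ) {a b c d o : V} (hd : IsTetra G a b c d)
    (ho : IsTetra G a b c o) (hdo : d ≠ o) :
    farSide (φ a) (φ b) (φ d) (φ c) ⊆ farSide (φ a) (φ b) (φ c) (φ o) := by
  intro x hx
  rcases h.xor_inTri hd ho hdo with ⟨h1, h2⟩ | ⟨h1, h2⟩
  · have n1 := hx.elim (fun h => h.1) (fun h => absurd h.1 h1.not_inTri_corner)
    exact Or.inl ⟨h1.trans n1, h2⟩
  · refine Or.inr ⟨h1, fun hxin => ?_⟩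
    rcases h.inTri_of_isTetra hd with h' | h' | h' | h'
    · have n1 : ¬ InTri (φ a) (φ b) (φ d) (φ c) := fun h2 =>
        h'.rotate.rotate.not_inTri_corner h2.swap.rotate.rotate
      have n2 := hx.elim (fun h => h.1) (fun h => absurd h.1 n1)
      exact h'.rotate.rotate.not_inTri_of_inTri n2.swap.rotate.rotate hxin.rotate
    · have n1 : ¬ InTri (φ a) (φ b) (φ d) (φ c) := fun h2 =>
        h'.rotate.rotate.not_inTri_corner h2.rotate.rotate
      have n2 := hx.elim (fun h => h.1) (fun h => absurd h.1 n1)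
      exact h'.rotate.rotate.not_inTri_of_inTri n2.rotate.rotate hxin.swap.rotate
    · exact hx.elim (fun h => h.2 h') (fun h => h.2 (h'.trans hxin))
    · exact h2 h'

end IsDrawing

/-! ### Stacked triangulations from choice sequences, and recovering the sequence from a placement
-/

/-- The edges from a new vertex `d` to the vertices of the face `abc`. -/
def spokes {V : Type*} (a b c d : V) : SimpleGraph V :=
  SimpleGraph.fromEdgeSet {s(a, d), s(b, d), s(c, d)}

/-- The stacked triangulation obtained from `K₄` on `v 0, …, v 3` by `k` further splits, the `i`-th
of which puts `v (i + 4)` into the face number `s i`; together with the list of faces other than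
`v 0, v 1, v 2`. A face is recorded with a further common neighbour of its vertices. -/
def stackState {V : Type*} (v : ℕ → V) (s : ℕ → ℕ) : ℕ → List (V × V × V × V) × SimpleGraph V
  | 0 => ([(v 0, v 1, v 3, v 2), (v 0, v 2, v 3, v 1), (v 1, v 2, v 3, v 0)],
      SimpleGraph.fromEdgeSet {s(v 0, v 1), s(v 0, v 2), s(v 1, v 2)} ⊔
        spokes (v 0) (v 1) (v 2) (v 3))
  | k + 1 =>
    match (stackState v s k).1[s k]? with
    | some (a, b, c, _) =>
      ((a, b, v (k + 4), c) :: (a, c, v (k + 4), b) :: (b, c, v (k + 4), a) ::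
        (stackState v s k).1.eraseIdx (s k), (stackState v s k).2 ⊔ spokes a b c (v (k + 4)))
    | none => stackState v s k

section stackState

variable {V : Type*} {v : ℕ → V} {s t : ℕ → ℕ}

theorem spokes_adj {a b c d x y : V} : (spokes a b c d).Adj x y ↔
    x ≠ y ∧ ((y = d ∧ (x = a ∨ x = b ∨ x = c)) ∨ (x = d ∧ (y = a ∨ y = b ∨ y = c))) := by
  simp only [spokes, SimpleGraph.fromEdgeSet_adj, Set.mem_insert_iff, Set.mem_singleton_iff,
    Sym2.eq_iff, ne_eq]
  tauto

/-- A split replaces one face by three. Thus the bound `s k < 2 * k + 3` says exactly that index `s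
k` is valid, and the fallback branch of `stackState` is never reached. -/
theorem length_stackState (hs : ∀ k, s k < 2 * k + 3) (k : ℕ) :
    (stackState v s k).1.length = 2 * k + 3 := by
  induction k with
  | zero => simp [stackState]
  | succ k ih =>
    have h := hs k
    rw [← ih] at h
    simp only [stackState, List.getElem?_eq_getElem h, List.length_cons, List.length_eraseIdx, h,
      if_true]
    omega

theorem stackState_succ (hs : ∀ k, s k < 2 * k + 3) (k : ℕ) : ∃ a b c o L,
    (stackState v s k).1[s k]? = some (a, b, c, o) ∧
    (stackState v s k).1.Perm ((a, b, c, o) :: L) ∧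
    stackState v s (k + 1) = ((a, b, v (k + 4), c) :: (a, c, v (k + 4), b) ::
      (b, c, v (k + 4), a) :: L, (stackState v s k).2 ⊔ spokes a b c (v (k + 4))) := by
  have h := hs k
  rw [← length_stackState (v := v) hs k] at h
  obtain ⟨⟨a, b, c, o⟩, hf⟩ : ∃ f, (stackState v s k).1[s k] = f := ⟨_, rfl⟩
  have hf' : (stackState v s k).1[s k]? = some (a, b, c, o) := by
    rw [List.getElem?_eq_getElem h, hf]
  refine ⟨a, b, c, o, (stackState v s k).1.eraseIdx (s k), hf', ?_, ?_⟩
  · rw [← hf]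
    exact (List.getElem_cons_eraseIdx_perm h).symm
  · rw [stackState, hf']

/-- The list order of the faces is fixed by the earlier choices, so face numbers are comparable
between sequences with a common prefix. -/
theorem stackState_congr {k : ℕ} (h : ∀ i < k, s i = t i) : stackState v s k = stackState v t k := by
  induction k with
  | zero => rfl
  | succ k ih =>
    rw [stackState, stackState, ih fun i hi => h i (by omega), h k (by omega)]

theorem stackState_mono (hs : ∀ k, s k < 2 * k + 3) :
    Monotone fun k => (stackState v s k).2 := by
  refine monotone_nat_of_le_succ fun k => ?_
  obtain ⟨a, b, c, o, L, -, -, h⟩ := stackState_succ (v := v) hs k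
  simp only [h]
  exact le_sup_left

theorem mem_image_of_mem_faces (hs : ∀ k, s k < 2 * k + 3) (k : ℕ) :
    ∀ f ∈ (stackState v s k).1, f.1 ∈ v '' Set.Iio (k + 4) ∧ f.2.1 ∈ v '' Set.Iio (k + 4) ∧
      f.2.2.1 ∈ v '' Set.Iio (k + 4) ∧ f.2.2.2 ∈ v '' Set.Iio (k + 4) := by
  induction k with
  | zero =>
    have h : ∀ i < 4, v i ∈ v '' Set.Iio (0 + 4) := fun i hi => ⟨i, by simpa using hi, rfl⟩
    simp only [stackState, List.mem_cons, List.not_mem_nil, or_false, forall_eq_or_imp, forall_eq]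
    simp only [h 0 (by omega), h 1 (by omega), h 2 (by omega), h 3 (by omega), and_self]
  | succ k ih =>
    obtain ⟨a, b, c, o, L, -, hp, h⟩ := stackState_succ (v := v) hs k
    have hm : v '' Set.Iio (k + 4) ⊆ v '' Set.Iio (k + 1 + 4) :=
      Set.image_mono (Set.Iio_subset_Iio (by omega))
    have hd : v (k + 4) ∈ v '' Set.Iio (k + 1 + 4) := ⟨k + 4, by simp, rfl⟩
    have hL : ∀ f ∈ (a, b, c, o) :: L, f.1 ∈ v '' Set.Iio (k + 1 + 4) ∧
        f.2.1 ∈ v '' Set.Iio (k + 1 + 4) ∧ f.2.2.1 ∈ v '' Set.Iio (k + 1 + 4) ∧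
          f.2.2.2 ∈ v '' Set.Iio (k + 1 + 4) := fun f hf => by
      obtain ⟨h1, h2, h3, h4⟩ := ih f (hp.mem_iff.2 hf)
      exact ⟨hm h1, hm h2, hm h3, hm h4⟩
    simp only [List.mem_cons, forall_eq_or_imp] at hL
    simp only [h, List.mem_cons, forall_eq_or_imp]
    obtain ⟨⟨ha, hb, hc, -⟩, hL⟩ := hL
    exact ⟨⟨ha, hb, hd, hc⟩, ⟨ha, hc, hd, hb⟩, ⟨hb, hc, hd, ha⟩, hL⟩

/-- The vertices of a face are distinct from the vertex added later. -/
theorem ne_of_mem_image {N k : ℕ} (hv : Set.InjOn v (Set.Iio (N + 4))) (hk : k < N) {x : V}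
    (hx : x ∈ v '' Set.Iio (k + 4)) : x ≠ v (k + 4) := by
  obtain ⟨i, hi, rfl⟩ := hx
  rw [Set.mem_Iio] at hi
  intro h
  have := hv (Set.mem_Iio.2 (by omega)) (Set.mem_Iio.2 (by omega)) h
  omega

theorem isTetra_of_mem_faces {N : ℕ} (hv : Set.InjOn v (Set.Iio (N + 4)))
    (hs : ∀ k, s k < 2 * k + 3) {k : ℕ} (hk : k ≤ N) : ∀ f ∈ (stackState v s k).1,
      IsTetra (stackState v s k).2 f.1 f.2.1 f.2.2.1 f.2.2.2 := by
  induction k with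
  | zero =>
    have hne : ∀ i < 4, ∀ j < 4, i ≠ j → v i ≠ v j := fun i hi j hj hij h =>
      hij (hv (Set.mem_Iio.2 (by omega)) (Set.mem_Iio.2 (by omega)) h)
    have h : IsTetra (stackState v s 0).2 (v 0) (v 1) (v 2) (v 3) := by
      simp [IsTetra, stackState, spokes_adj, hne]
    simp only [stackState, List.mem_cons, List.not_mem_nil, or_false, forall_eq_or_imp, forall_eq]
    exact ⟨h.swap_last, h.rotate.rotate.swap.swap_last, h.rotate.swap_last⟩
  | succ k ih =>
    obtain ⟨a, b, c, o, L, -, hp, h⟩ := stackState_succ (v := v) hs k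
    have hf := (hp.mem_iff (a := (a, b, c, o))).2 List.mem_cons_self
    obtain ⟨ha, hb, hc, -⟩ := mem_image_of_mem_faces hs k _ hf
    have ht := ih (by omega) _ hf
    have hd : IsTetra ((stackState v s k).2 ⊔ spokes a b c (v (k + 4))) a b c (v (k + 4)) := by
      refine ⟨Or.inl ht.1, Or.inl ht.2.1, Or.inr ?_, Or.inl ht.2.2.2.1, Or.inr ?_, Or.inr ?_⟩ <;>
        rw [spokes_adj] <;> refine ⟨ne_of_mem_image hv (by omega) (by assumption), ?_⟩ <;> simp
    simp only [h, List.mem_cons, forall_eq_or_imp]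
    exact ⟨hd.swap_last, hd.rotate.rotate.swap.swap_last, hd.rotate.swap_last,
      fun f hf => (ih (by omega) f (hp.mem_iff.2 (List.mem_cons_of_mem _ hf))).mono le_sup_left⟩

/-- The region of a face in a straight-line drawing. -/
def faceRegion (φ : V → Plane) (f : V × V × V × V) : Set Plane :=
  farSide (φ f.1) (φ f.2.1) (φ f.2.2.1) (φ f.2.2.2)

theorem IsDrawing.pairwise_disjoint_tetra {G : SimpleGraph V} {φ : V → Plane}
    (hG : IsDrawing G φ) {a b c d : V} (ht : IsTetra G a b c d) :
    Disjoint (faceRegion φ (a, b, d, c)) (faceRegion φ (b, c, d, a)) ∧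
      Disjoint (faceRegion φ (a, b, d, c)) (faceRegion φ (a, c, d, b)) ∧
      Disjoint (faceRegion φ (a, c, d, b)) (faceRegion φ (b, c, d, a)) := by
  have h1 := hG.disjoint_farSide ht
  have h2 := hG.disjoint_farSide ht.swap
  have h3 := hG.disjoint_farSide ht.swap.rotate
  rw [farSide_swap] at h2
  rw [farSide_swap (φ b)] at h3
  exact ⟨h1, h2, h3⟩

/-- Induction on the stage within a drawing of the final graph: the three new regions are disjoint
inside one K₄ and contained in the region they replace. -/
theorem IsDrawing.pairwise_disjoint_faceRegion {N : ℕ} (hv : Set.InjOn v (Set.Iio (N + 4)))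
    (hs : ∀ k, s k < 2 * k + 3) {φ : V → Plane} (hG : IsDrawing (stackState v s N).2 φ)
    {k : ℕ} (hk : k ≤ N) :
    (stackState v s k).1.Pairwise fun f g => Disjoint (faceRegion φ f) (faceRegion φ g) := by
  induction k with
  | zero =>
    have ht := isTetra_of_mem_faces hv hs hk (v 0, v 1, v 3, v 2) (by simp [stackState])
    obtain ⟨h1, h2, h3⟩ := hG.pairwise_disjoint_tetra
      (ht.swap_last.mono (stackState_mono hs hk))
    simp only [stackState, List.pairwise_cons, List.mem_cons, List.not_mem_nil, or_false,
      forall_eq_or_imp, forall_eq]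
    simp only [h1, h2, h3]
    simp
  | succ k ih =>
    obtain ⟨a, b, c, o, L, -, hp, h⟩ := stackState_succ (v := v) hs k
    have hf := (hp.mem_iff (a := (a, b, c, o))).2 List.mem_cons_self
    have ho := (isTetra_of_mem_faces hv hs (by omega) _ hf).mono
      (stackState_mono hs (show k ≤ N by omega))
    have hd := ((isTetra_of_mem_faces hv hs hk (a, b, v (k + 4), c)
      (by simp [h])).mono (stackState_mono hs hk)).swap_last
    have hne := (ne_of_mem_image hv hk (mem_image_of_mem_faces hs k _ hf).2.2.2).symm
    obtain ⟨h1, h2, h3⟩ := hG.pairwise_disjoint_tetra hd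
    have hw := (hp.pairwise_iff fun {x y} h => h.symm).1 (ih (by omega))
    rw [List.pairwise_cons] at hw
    have s1 : faceRegion φ (a, b, v (k + 4), c) ⊆ faceRegion φ (a, b, c, o) :=
      hG.farSide_subset hd ho hne
    have s2 : faceRegion φ (b, c, v (k + 4), a) ⊆ faceRegion φ (a, b, c, o) := by
      have := hG.farSide_subset hd.rotate ho.rotate hne
      rwa [farSide_rotate (φ a)] at this
    have s3 : faceRegion φ (a, c, v (k + 4), b) ⊆ faceRegion φ (a, b, c, o) := by
      have := hG.farSide_subset hd.rotate.rotate ho.rotate.rotate hne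
      rwa [farSide_rotate (φ b), farSide_rotate (φ a), farSide_swap (φ a)] at this
    simp only [h, List.pairwise_cons, List.mem_cons, forall_eq_or_imp]
    exact ⟨⟨h2, h1, fun f hf => (hw.1 f hf).mono_left s1⟩, ⟨h3, fun f hf => (hw.1 f hf).mono_left s3⟩,
      fun f hf => (hw.1 f hf).mono_left s2, hw.2⟩

/-- The new vertex and the recorded neighbour of the face are two common neighbours of its corners,
so the triangle separates them. -/
theorem IsDrawing.mem_faceRegion {N : ℕ} (hv : Set.InjOn v (Set.Iio (N + 4)))
    (hs : ∀ k, s k < 2 * k + 3) {φ : V → Plane} (hG : IsDrawing (stackState v s N).2 φ)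
    {k : ℕ} (hk : k < N) : ∃ h : s k < (stackState v s k).1.length,
      φ (v (k + 4)) ∈ faceRegion φ (stackState v s k).1[s k] := by
  obtain ⟨a, b, c, o, L, he, hp, h⟩ := stackState_succ (v := v) hs k
  obtain ⟨hlt, he⟩ := List.getElem?_eq_some_iff.1 he
  refine ⟨hlt, ?_⟩
  rw [he]
  have hf := (hp.mem_iff (a := (a, b, c, o))).2 List.mem_cons_self
  have ho := (isTetra_of_mem_faces hv hs hk.le _ hf).mono (stackState_mono hs hk.le)
  have hd := ((isTetra_of_mem_faces hv hs hk (a, b, v (k + 4), c)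
    (by simp [h])).mono (stackState_mono hs hk)).swap_last
  exact hG.xor_inTri hd ho (ne_of_mem_image hv hk (mem_image_of_mem_faces hs k _ hf).2.2.2).symm

/-- The positions of the vertices determine the stacked triangulation. -/
theorem eq_of_isDrawing {N : ℕ} (hv : Set.InjOn v (Set.Iio (N + 4)))
    (hs : ∀ k, s k < 2 * k + 3) (ht : ∀ k, t k < 2 * k + 3) {φ : V → Plane}
    (hGs : IsDrawing (stackState v s N).2 φ) (hGt : IsDrawing (stackState v t N).2 φ) :
    ∀ k < N, s k = t k := by
  intro k
  induction k using Nat.strong_induction_on with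
  | _ k ih =>
    intro hk
    -- Equal prefixes give the same face list, so the new vertex lies in two regions of one disjoint
    -- family, and the indices must coincide.
    have heq : stackState v s k = stackState v t k :=
      stackState_congr fun i hi => ih i hi (by omega)
    obtain ⟨h1, h1'⟩ := hGs.mem_faceRegion hv hs hk
    obtain ⟨h2, h2'⟩ := hGt.mem_faceRegion hv ht hk
    simp only [← heq] at h2 h2'
    have hw := hGs.pairwise_disjoint_faceRegion hv hs hk.le
    rw [List.pairwise_iff_getElem] at hw
    by_contra hne
    rcases Nat.lt_or_gt_of_ne hne with h | h
    · exact Set.disjoint_left.1 (hw _ _ h1 h2 h) h1' h2'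
    · exact Set.disjoint_left.1 (hw _ _ h2 h1 h) h2' h1'

/-- The appended `{v 0, v 1, v 2}` is the face that `stackState` leaves out because it is never
split. -/
theorem stacked_stackState [DecidableEq V] {N : ℕ} (hv : Set.InjOn v (Set.Iio (N + 4)))
    (hs : ∀ k, s k < 2 * k + 3) {k : ℕ} (hk : k ≤ N) :
    Stacked ((Finset.range (k + 4)).image v) (stackState v s k).2
      (((stackState v s k).1.map fun f => ({f.1, f.2.1, f.2.2.1} : Finset V)) ++
        [({v 0, v 1, v 2} : Finset V)] : List (Finset V)) := by
  induction k with
  | zero =>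
    have hne : ∀ i < 4, ∀ j < 4, i ≠ j → v i ≠ v j := fun i hi j hj hij h =>
      hij (hv (Set.mem_Iio.2 (by omega)) (Set.mem_Iio.2 (by omega)) h)
    have h := Stacked.split _ _ _ _ _ _ (v 3) (Stacked.triangle (v 0) (v 1) (v 2)
      (hne 0 (by omega) 1 (by omega) (by omega)) (hne 0 (by omega) 2 (by omega) (by omega))
      (hne 1 (by omega) 2 (by omega) (by omega))) (by simp [hne])
    have hS : (Finset.range (0 + 4)).image v = {v 3, v 0, v 1, v 2} := by
      ext x
      simp only [Finset.mem_image, Finset.mem_range, Finset.mem_insert, Finset.mem_singleton]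
      constructor
      · rintro ⟨i, hi, rfl⟩
        interval_cases i <;> simp
      · rintro (rfl | rfl | rfl | rfl)
        exacts [⟨3, by omega, rfl⟩, ⟨0, by omega, rfl⟩, ⟨1, by omega, rfl⟩, ⟨2, by omega, rfl⟩]
    rw [hS]
    exact h
  | succ k ih =>
    obtain ⟨a, b, c, o, L, -, hp, h⟩ := stackState_succ (v := v) hs k
    have h' := ih (by omega)
    have hd : v (k + 4) ∉ (Finset.range (k + 4)).image v := by
      intro hm
      obtain ⟨i, hi, hi'⟩ := Finset.mem_image.1 hm
      rw [Finset.mem_range] at hi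
      exact ne_of_mem_image hv hk ⟨i, hi, hi'⟩ rfl
    have hperm : ((((stackState v s k).1.map fun f => ({f.1, f.2.1, f.2.2.1} : Finset V)) ++
        [({v 0, v 1, v 2} : Finset V)] : List (Finset V)) : Multiset (Finset V)) =
        ({a, b, c} : Finset V) ::ₘ (((L.map fun f => ({f.1, f.2.1, f.2.2.1} : Finset V)) ++
          [({v 0, v 1, v 2} : Finset V)] : List (Finset V)) : Multiset (Finset V)) := by
      rw [Multiset.cons_coe, Multiset.coe_eq_coe]
      exact ((hp.map _).append_right _)
    rw [hperm] at h'
    have h2 := Stacked.split _ _ _ _ _ _ (v (k + 4)) h' hd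
    rw [h, show k + 1 + 4 = (k + 4) + 1 by omega, Finset.range_add_one, Finset.image_insert]
    exact h2

end stackState

/-! ### Every stacked triangulation has a straight-line drawing -/

theorem orient_combo {a b x y : Plane} {s t : ℝ} (h : s + t = 1) :
    orient a b (s • x + t • y) = s * orient a b x + t * orient a b y := by
  obtain rfl : s = 1 - t := by linarith
  simp [orient]; ring

theorem InTri.of_mem_openSegment {a b c x p : Plane} (hx : InTri a b c x)
    (hp : p ∈ openSegment ℝ a x) : InTri a b c p := by
  obtain ⟨s, t, hs, ht, hst, rfl⟩ := hp
  have h := orient_add a b c x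
  have e := orient_cycle a b c
  unfold InTri at *
  simp only [orient_combo hst, orient_left, orient_right, mul_zero, zero_add, e]
  rcases hx with ⟨h1, h2, h3⟩ | ⟨h1, h2, h3⟩
  · left
    have : 0 < orient a b c := by linarith
    exact ⟨by positivity, by positivity, by positivity⟩
  · right
    have : orient a b c < 0 := by linarith
    exact ⟨mul_neg_of_pos_of_neg ht h1,
      add_neg (mul_neg_of_pos_of_neg hs this) (mul_neg_of_pos_of_neg ht h2),
      mul_neg_of_pos_of_neg ht h3⟩

theorem disjoint_openSegment_of_orient_ne_zero {x a b : Plane} (h : orient a b x ≠ 0) :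
    Disjoint (openSegment ℝ a x) (openSegment ℝ b x) := by
  rw [Set.disjoint_left]
  rintro p ⟨s, t, hs, ht, hst, rfl⟩ ⟨s', t', hs', ht', hst', h'⟩
  have h1 := orient_combo (a := x) (b := a) (x := b) (y := x) hst'
  rw [h', orient_combo hst, orient_left, orient_right, ← orient_cycle x a b] at h1
  simp only [mul_zero, add_zero] at h1
  exact (mul_ne_zero hs'.ne' h) h1.symm

theorem not_inTri_of_mem_openSegment {a b x p : Plane} (hp : p ∈ openSegment ℝ a x) :
    ¬ InTri a b x p := by
  obtain ⟨s, t, hs, ht, hst, rfl⟩ := hp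
  simp [InTri, orient_combo hst]

theorem InTri.not_inTri_of_mem_openSegment {a b c x p : Plane} (hx : InTri a b c x)
    (hp : p ∈ openSegment ℝ c x) : ¬ InTri a b x p := by
  obtain ⟨s, t, hs, ht, hst, rfl⟩ := hp
  unfold InTri at *
  simp only [orient_combo hst, orient_left, orient_right, mul_zero, add_zero, orient_swap' b c x]
  rcases hx with ⟨h1, h2, h3⟩ | ⟨h1, h2, h3⟩
  · rintro (⟨-, h, -⟩ | ⟨h, -, -⟩)
    · nlinarith
    · have h4 := orient_add a b c x
      nlinarith
  · rintro (⟨h, -, -⟩ | ⟨-, h, -⟩)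
    · have h4 := orient_add a b c x
      nlinarith
    · nlinarith

theorem exists_inTri {a b c : Plane} (h : orient a b c ≠ 0) : ∃ x, InTri a b c x := by
  refine ⟨(1 / 3 : ℝ) • (a + b + c), ?_⟩
  have h1 : orient a b ((1 / 3 : ℝ) • (a + b + c)) = orient a b c / 3 := by
    simp [orient]; ring
  have h2 : orient b c ((1 / 3 : ℝ) • (a + b + c)) = orient a b c / 3 := by
    simp [orient]; ring
  have h3 : orient c a ((1 / 3 : ℝ) • (a + b + c)) = orient a b c / 3 := by
    simp [orient]; ring
  unfold InTri
  rw [h1, h2, h3]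
  rcases h.lt_or_gt with h | h
  · exact Or.inr ⟨by linarith, by linarith, by linarith⟩
  · exact Or.inl ⟨by linarith, by linarith, by linarith⟩

section InnerDrawing

variable {V : Type*} {G : SimpleGraph V} {φ ψ : V → Plane} {U : Set V}

/-- The open triangle on the vertices of a face. -/
def faceInterior (φ : V → Plane) (f : V × V × V × V) : Set Plane :=
  {x | InTri (φ f.1) (φ f.2.1) (φ f.2.2.1) x}

/-- A straight-line drawing of `G` on the vertex set `U`, in which the triangles listed in `L` are
inner faces. -/
structure InnerDrawing (U : Set V) (G : SimpleGraph V) (L : List (V × V × V × V))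
    (φ : V → Plane) : Prop where
  mem_of_adj : ∀ u w, G.Adj u w → u ∈ U ∧ w ∈ U
  mem_of_face : ∀ f ∈ L, f.1 ∈ U ∧ f.2.1 ∈ U ∧ f.2.2.1 ∈ U
  injOn : Set.InjOn φ U
  eq_of_mem : ∀ u v w, G.Adj u v → w ∈ U → φ w ∈ segment ℝ (φ u) (φ v) → w = u ∨ w = v
  disjoint : ∀ u v u' v', G.Adj u v → G.Adj u' v' → s(u, v) ≠ s(u', v') →
    Disjoint (openSegment ℝ (φ u) (φ v)) (openSegment ℝ (φ u') (φ v'))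
  orient_ne_zero : ∀ f ∈ L, orient (φ f.1) (φ f.2.1) (φ f.2.2.1) ≠ 0
  vertex_notMem : ∀ f ∈ L, ∀ w ∈ U, φ w ∉ faceInterior φ f
  edge_disjoint : ∀ f ∈ L, ∀ u v, G.Adj u v →
    Disjoint (openSegment ℝ (φ u) (φ v)) (faceInterior φ f)
  face_disjoint : L.Pairwise fun f g => Disjoint (faceInterior φ f) (faceInterior φ g)

theorem InnerDrawing.perm {L L' : List (V × V × V × V)} (h : InnerDrawing U G L φ)
    (hL : L.Perm L') : InnerDrawing U G L' φ where
  mem_of_adj := h.mem_of_adj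
  mem_of_face f hf := h.mem_of_face f (hL.mem_iff.2 hf)
  injOn := h.injOn
  eq_of_mem := h.eq_of_mem
  disjoint := h.disjoint
  orient_ne_zero f hf := h.orient_ne_zero f (hL.mem_iff.2 hf)
  vertex_notMem f hf := h.vertex_notMem f (hL.mem_iff.2 hf)
  edge_disjoint f hf := h.edge_disjoint f (hL.mem_iff.2 hf)
  face_disjoint := (hL.pairwise_iff fun {_ _} h => h.symm).1 h.face_disjoint

/-- Splitting an inner face extends a drawing. -/
theorem InnerDrawing.split {L : List (V × V × V × V)} {a b c o d o₁ o₂ o₃ : V}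
    (h : InnerDrawing U G ((a, b, c, o) :: L) φ) (hd : d ∉ U) (hψ : ∀ u ∈ U, ψ u = φ u)
    (hx : InTri (φ a) (φ b) (φ c) (ψ d)) :
    InnerDrawing (insert d U) (G ⊔ spokes a b c d)
      ((a, b, d, o₁) :: (a, c, d, o₂) :: (b, c, d, o₃) :: L) ψ := by
  obtain ⟨ha, hb, hc⟩ := h.mem_of_face _ List.mem_cons_self
  dsimp only at ha hb hc
  have hψa := hψ a ha
  have hψb := hψ b hb
  have hψc := hψ c hc
  set x := ψ d with hxd
  have had : a ≠ d := fun h => hd (h ▸ ha)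
  have hbd : b ≠ d := fun h => hd (h ▸ hb)
  have hcd : c ≠ d := fun h => hd (h ▸ hc)
  have hnv := h.vertex_notMem _ List.mem_cons_self
  have hne := h.edge_disjoint _ List.mem_cons_self
  have hff := (List.pairwise_cons.1 h.face_disjoint)
  -- spokes lie inside the face that is split
  have hspoke : ∀ t, t = a ∨ t = b ∨ t = c → openSegment ℝ (φ t) x ⊆ faceInterior φ (a, b, c, o) := by
    rintro t (rfl | rfl | rfl) p hp
    · exact hx.of_mem_openSegment hp
    · exact (hx.rotate.of_mem_openSegment hp).rotate.rotate
    · exact (hx.rotate.rotate.of_mem_openSegment hp).rotate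
  have hold : ∀ u w, G.Adj u w → ψ u = φ u ∧ ψ w = φ w := fun u w huw =>
    ⟨hψ u (h.mem_of_adj u w huw).1, hψ w (h.mem_of_adj u w huw).2⟩
  have hnew : ∀ u w, (spokes a b c d).Adj u w → ∃ t, (t = a ∨ t = b ∨ t = c) ∧
      s(u, w) = s(t, d) ∧ openSegment ℝ (ψ u) (ψ w) = openSegment ℝ (φ t) x ∧
      segment ℝ (ψ u) (ψ w) = segment ℝ (φ t) x := by
    intro u w huw
    rw [spokes_adj] at huw
    have hψt : ∀ t, t = a ∨ t = b ∨ t = c → ψ t = φ t := by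
      rintro t (rfl | rfl | rfl) <;> assumption
    rcases huw with ⟨-, ⟨rfl, ht⟩ | ⟨rfl, ht⟩⟩
    · exact ⟨u, ht, rfl, by rw [hψt u ht], by rw [hψt u ht]⟩
    · exact ⟨w, ht, Sym2.eq_swap, by rw [hψt w ht, openSegment_symm],
        by rw [hψt w ht, segment_symm]⟩
  have hfold : ∀ f ∈ L, faceInterior ψ f = faceInterior φ f := fun f hf => by
    obtain ⟨h1, h2, h3⟩ := h.mem_of_face f (List.mem_cons_of_mem _ hf)
    simp only [faceInterior, hψ _ h1, hψ _ h2, hψ _ h3]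
  have htmem : ∀ t, t = a ∨ t = b ∨ t = c → t ∈ U := by
    rintro t (rfl | rfl | rfl) <;> assumption
  have i1 : faceInterior ψ (a, b, d, o₁) ⊆ faceInterior φ (a, b, c, o) := fun y hy => by
    simp only [faceInterior, hψa, hψb] at hy
    exact hx.trans hy
  have i2 : faceInterior ψ (a, c, d, o₂) ⊆ faceInterior φ (a, b, c, o) := fun y hy => by
    simp only [faceInterior, hψa, hψc] at hy
    exact (hx.rotate.rotate.trans hy.swap).rotate
  have i3 : faceInterior ψ (b, c, d, o₃) ⊆ faceInterior φ (a, b, c, o) := fun y hy => by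
    simp only [faceInterior, hψb, hψc] at hy
    exact (hx.rotate.trans hy).rotate.rotate
  -- spokes do not enter the new faces
  have hsp : ∀ t, t = a ∨ t = b ∨ t = c → ∀ p ∈ openSegment ℝ (φ t) x,
      p ∉ faceInterior ψ (a, b, d, o₁) ∧ p ∉ faceInterior ψ (a, c, d, o₂) ∧
        p ∉ faceInterior ψ (b, c, d, o₃) := by
    intro t ht p hp
    simp only [faceInterior, hψa, hψb, hψc, ← hxd, Set.mem_ofPred_eq]
    rcases ht with rfl | rfl | rfl
    · exact ⟨not_inTri_of_mem_openSegment hp, not_inTri_of_mem_openSegment hp,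
        hx.rotate.not_inTri_of_mem_openSegment hp⟩
    · exact ⟨fun h => not_inTri_of_mem_openSegment hp h.swap,
        fun h => hx.rotate.rotate.not_inTri_of_mem_openSegment hp h.swap,
        not_inTri_of_mem_openSegment hp⟩
    · exact ⟨hx.not_inTri_of_mem_openSegment hp,
        fun h => not_inTri_of_mem_openSegment hp h.swap,
        fun h => not_inTri_of_mem_openSegment hp h.swap⟩
  have o1 := hx.orient_ne_zero
  have q1 : orient (φ a) (φ b) x ≠ 0 := by rcases hx with hx | hx; exacts [hx.1.ne', hx.1.ne]
  have q2 : orient (φ b) (φ c) x ≠ 0 := by rcases hx with hx | hx; exacts [hx.2.1.ne', hx.2.1.ne]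
  have q3 : orient (φ c) (φ a) x ≠ 0 := by rcases hx with hx | hx; exacts [hx.2.2.ne', hx.2.2.ne]
  constructor
  · rintro u w (huw | huw)
    · exact ⟨Or.inr (h.mem_of_adj u w huw).1, Or.inr (h.mem_of_adj u w huw).2⟩
    · rw [spokes_adj] at huw
      rcases huw with ⟨-, ⟨rfl, ht⟩ | ⟨rfl, ht⟩⟩
      · exact ⟨Or.inr (htmem _ ht), Or.inl rfl⟩
      · exact ⟨Or.inl rfl, Or.inr (htmem _ ht)⟩
  · simp only [List.mem_cons, forall_eq_or_imp]
    refine ⟨⟨Or.inr ha, Or.inr hb, Or.inl rfl⟩, ⟨Or.inr ha, Or.inr hc, Or.inl rfl⟩,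
      ⟨Or.inr hb, Or.inr hc, Or.inl rfl⟩, fun f hf => ?_⟩
    obtain ⟨h1, h2, h3⟩ := h.mem_of_face f (List.mem_cons_of_mem _ hf)
    exact ⟨Or.inr h1, Or.inr h2, Or.inr h3⟩
  · rw [Set.injOn_insert hd]
    refine ⟨fun u hu w hw huw => h.injOn hu hw (by rwa [hψ u hu, hψ w hw] at huw), ?_⟩
    rintro ⟨u, hu, hux⟩
    rw [hψ u hu] at hux
    exact hnv u hu (by rw [hux]; exact hx)
  · rintro u w z (huw | huw) hz hmem
    · obtain ⟨h1, h2⟩ := hold u w huw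
      rw [h1, h2] at hmem
      rcases hz with rfl | hz
      · exfalso
        rw [← insert_endpoints_openSegment, Set.mem_insert_iff, Set.mem_insert_iff] at hmem
        rcases hmem with hm | hm | hm
        · exact hnv u (h.mem_of_adj u w huw).1 (by rw [← hm]; exact hx)
        · exact hnv w (h.mem_of_adj u w huw).2 (by rw [← hm]; exact hx)
        · exact Set.disjoint_left.1 (hne u w huw) hm hx
      · rw [hψ z hz] at hmem
        exact h.eq_of_mem u w z huw hz hmem
    · obtain ⟨t, ht, he, -, hseg⟩ := hnew u w huw
      have : z = t ∨ z = d := by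
        rcases hz with rfl | hz
        · exact Or.inr rfl
        · rw [hseg, hψ z hz, ← insert_endpoints_openSegment, Set.mem_insert_iff,
            Set.mem_insert_iff] at hmem
          rcases hmem with hm | hm | hm
          · exact Or.inl (h.injOn hz (htmem t ht) hm)
          · exact absurd (show φ z ∈ faceInterior φ (a, b, c, o) by rw [hm]; exact hx) (hnv z hz)
          · exact absurd (hspoke t ht hm) (hnv z hz)
      have hz' : z ∈ s(u, w) := by rw [he]; exact Sym2.mem_iff.2 this
      exact Sym2.mem_iff.1 hz'
  · have hon : ∀ u w u' w', G.Adj u w → (spokes a b c d).Adj u' w' →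
        Disjoint (openSegment ℝ (ψ u) (ψ w)) (openSegment ℝ (ψ u') (ψ w')) := by
      intro u w u' w' h1 h2
      obtain ⟨t, ht, -, hseg, -⟩ := hnew u' w' h2
      rw [hseg, (hold u w h1).1, (hold u w h1).2]
      exact (hne u w h1).mono_right (hspoke t ht)
    rintro u w u' w' (h1 | h1) (h2 | h2) hne'
    · rw [(hold u w h1).1, (hold u w h1).2, (hold u' w' h2).1, (hold u' w' h2).2]
      exact h.disjoint u w u' w' h1 h2 hne'
    · exact hon u w u' w' h1 h2
    · exact (hon u' w' u w h2 h1).symm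
    · obtain ⟨t, ht, he, hseg, -⟩ := hnew u w h1
      obtain ⟨t', ht', he', hseg', -⟩ := hnew u' w' h2
      rw [hseg, hseg']
      have hab := disjoint_openSegment_of_orient_ne_zero q1
      have hbc := disjoint_openSegment_of_orient_ne_zero q2
      have hca := disjoint_openSegment_of_orient_ne_zero q3
      rcases ht with rfl | rfl | rfl <;> rcases ht' with rfl | rfl | rfl <;>
        first
          | exact absurd (he.trans he'.symm) hne'
          | assumption
          | exact Disjoint.symm (by assumption)
  · simp only [List.mem_cons, forall_eq_or_imp, hψa, hψb, hψc, ← hxd]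
    refine ⟨q1, by rw [orient_swap]; exact neg_ne_zero.2 q3, q2, fun f hf => ?_⟩
    obtain ⟨h1, h2, h3⟩ := h.mem_of_face f (List.mem_cons_of_mem _ hf)
    rw [hψ _ h1, hψ _ h2, hψ _ h3]
    exact h.orient_ne_zero f (List.mem_cons_of_mem _ hf)
  · have hv' : ∀ F : Set Plane, F ⊆ faceInterior φ (a, b, c, o) → x ∉ F →
        ∀ w ∈ insert d U, ψ w ∉ F := by
      rintro F hF hxF w (rfl | hw)
      · exact hxF
      · rw [hψ w hw]; exact fun hm => hnv w hw (hF hm)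
    simp only [List.mem_cons, forall_eq_or_imp]
    refine ⟨hv' _ i1 not_inTri_right, hv' _ i2 not_inTri_right, hv' _ i3 not_inTri_right,
      fun f hf w hw => ?_⟩
    rw [hfold f hf]
    rcases hw with rfl | hw
    · exact Set.disjoint_left.1 (hff.1 f hf) hx
    · rw [hψ w hw]
      exact h.vertex_notMem f (List.mem_cons_of_mem _ hf) w hw
  · have he' : ∀ F : Set Plane, F ⊆ faceInterior φ (a, b, c, o) →
        (∀ t, t = a ∨ t = b ∨ t = c → Disjoint (openSegment ℝ (φ t) x) F) →
        ∀ u w, (G ⊔ spokes a b c d).Adj u w → Disjoint (openSegment ℝ (ψ u) (ψ w)) F := by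
      rintro F hF hsF u w (h1 | h1)
      · rw [(hold u w h1).1, (hold u w h1).2]
        exact (hne u w h1).mono_right hF
      · obtain ⟨t, ht, -, hseg, -⟩ := hnew u w h1
        rw [hseg]
        exact hsF t ht
    simp only [List.mem_cons, forall_eq_or_imp]
    refine ⟨he' _ i1 fun t ht => Set.disjoint_left.2 fun p hp => (hsp t ht p hp).1,
      he' _ i2 fun t ht => Set.disjoint_left.2 fun p hp => (hsp t ht p hp).2.1,
      he' _ i3 fun t ht => Set.disjoint_left.2 fun p hp => (hsp t ht p hp).2.2, ?_⟩
    rintro f hf u w (h1 | h1)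
    · rw [hfold f hf, (hold u w h1).1, (hold u w h1).2]
      exact h.edge_disjoint f (List.mem_cons_of_mem _ hf) u w h1
    · obtain ⟨t, ht, -, hseg, -⟩ := hnew u w h1
      rw [hseg, hfold f hf]
      exact (hff.1 f hf).mono_left (hspoke t ht)
  · have hL : L.Pairwise fun f g => Disjoint (faceInterior ψ f) (faceInterior ψ g) :=
      hff.2.imp_of_mem fun {f g} hf hg hfg => by rwa [hfold f hf, hfold g hg]
    have d1 : Disjoint (faceInterior ψ (a, b, d, o₁)) (faceInterior ψ (b, c, d, o₃)) := by
      simp only [faceInterior, hψa, hψb, hψc, ← hxd]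
      exact Set.disjoint_left.2 fun y hy => hx.not_inTri_of_inTri hy
    have d2 : Disjoint (faceInterior ψ (a, c, d, o₂)) (faceInterior ψ (b, c, d, o₃)) := by
      simp only [faceInterior, hψa, hψb, hψc, ← hxd]
      exact Set.disjoint_left.2 fun y hy hy' => hx.rotate.not_inTri_of_inTri hy' hy.swap
    have d3 : Disjoint (faceInterior ψ (a, b, d, o₁)) (faceInterior ψ (a, c, d, o₂)) := by
      simp only [faceInterior, hψa, hψb, hψc, ← hxd]
      exact Set.disjoint_left.2 fun y hy hy' => hx.rotate.rotate.not_inTri_of_inTri hy'.swap hy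
    have hs' : ∀ F, F ⊆ faceInterior φ (a, b, c, o) → ∀ f ∈ L, Disjoint F (faceInterior ψ f) :=
      fun F hF f hf => by rw [hfold f hf]; exact (hff.1 f hf).mono_left hF
    simp only [List.pairwise_cons, List.mem_cons, forall_eq_or_imp]
    exact ⟨⟨d3, d1, hs' _ i1⟩, ⟨d2, hs' _ i2⟩, hs' _ i3, hL⟩

theorem orient_eq_zero_of_mem_segment {a b p : Plane} (hp : p ∈ segment ℝ a b) :
    orient a b p = 0 := by
  obtain ⟨s, t, hs, ht, hst, rfl⟩ := hp
  simp [orient_combo hst]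

-- `o` only fills the fourth slot of the face record; no condition of `InnerDrawing` involves it.
open Classical in
theorem exists_innerDrawing_triangle {a b c : V} (hab : a ≠ b) (hac : a ≠ c) (hbc : b ≠ c)
    (o : V) : ∃ φ, InnerDrawing {a, b, c} (SimpleGraph.fromEdgeSet {s(a, b), s(a, c), s(b, c)})
      [(a, b, c, o)] φ := by
  obtain ⟨φ, hφ⟩ : ∃ φ : V → Plane, orient (φ a) (φ b) (φ c) ≠ 0 := by
    refine ⟨Function.update (Function.update (fun _ => !₂[0, 0]) b !₂[1, 0]) c !₂[0, 1], ?_⟩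
    simp [Function.update_of_ne, hab, hac, hbc, orient]
  have h2 : orient (φ a) (φ c) (φ b) ≠ 0 := by rw [orient_swap']; exact neg_ne_zero.2 hφ
  have h3 : orient (φ b) (φ c) (φ a) ≠ 0 := by rwa [orient_cycle]
  have nab : φ a ≠ φ b := fun h => hφ (by rw [h]; simp [orient])
  have nac : φ a ≠ φ c := fun h => hφ (by rw [h]; simp [orient])
  have nbc : φ b ≠ φ c := fun h => hφ (by rw [h, orient_right])
  have e1 := openSegment_symm ℝ (φ b) (φ a)
  have e2 := openSegment_symm ℝ (φ c) (φ a)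
  have e3 := openSegment_symm ℝ (φ c) (φ b)
  have d1 := disjoint_openSegment_of_orient_ne_zero hφ
  have d2 := disjoint_openSegment_of_orient_ne_zero h2
  have d3 := disjoint_openSegment_of_orient_ne_zero h3
  rw [e3] at d2
  rw [e1, e2] at d3
  have hadj : ∀ u w, (SimpleGraph.fromEdgeSet {s(a, b), s(a, c), s(b, c)}).Adj u w →
      (s(u, w) = s(a, b) ∧ segment ℝ (φ u) (φ w) = segment ℝ (φ a) (φ b) ∧
        openSegment ℝ (φ u) (φ w) = openSegment ℝ (φ a) (φ b)) ∨
      (s(u, w) = s(a, c) ∧ segment ℝ (φ u) (φ w) = segment ℝ (φ a) (φ c) ∧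
        openSegment ℝ (φ u) (φ w) = openSegment ℝ (φ a) (φ c)) ∨
      (s(u, w) = s(b, c) ∧ segment ℝ (φ u) (φ w) = segment ℝ (φ b) (φ c) ∧
        openSegment ℝ (φ u) (φ w) = openSegment ℝ (φ b) (φ c)) := by
    intro u w huw
    simp only [SimpleGraph.fromEdgeSet_adj, Set.mem_insert_iff, Set.mem_singleton_iff] at huw
    have hs : ∀ x y, s(u, w) = s(x, y) → s(u, w) = s(x, y) ∧
        segment ℝ (φ u) (φ w) = segment ℝ (φ x) (φ y) ∧
        openSegment ℝ (φ u) (φ w) = openSegment ℝ (φ x) (φ y) := by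
      intro x y h
      refine ⟨h, ?_⟩
      rcases Sym2.eq_iff.1 h with ⟨rfl, rfl⟩ | ⟨rfl, rfl⟩
      · exact ⟨rfl, rfl⟩
      · exact ⟨segment_symm _ _ _, openSegment_symm _ _ _⟩
    rcases huw.1 with h | h | h
    · exact Or.inl (hs _ _ h)
    · exact Or.inr (Or.inl (hs _ _ h))
    · exact Or.inr (Or.inr (hs _ _ h))
  have hmem : ∀ u w, (SimpleGraph.fromEdgeSet {s(a, b), s(a, c), s(b, c)}).Adj u w →
      ∀ z, (z = u ∨ z = w ↔ z ∈ s(u, w)) := fun _ _ _ z => Sym2.mem_iff.symm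
  refine ⟨φ, ⟨?_, ?_, ?_, ?_, ?_, ?_, ?_, ?_, ?_⟩⟩
  · intro u w huw
    have hu : u ∈ s(u, w) := by simp
    have hw : w ∈ s(u, w) := by simp
    rcases hadj u w huw with ⟨h, -, -⟩ | ⟨h, -, -⟩ | ⟨h, -, -⟩ <;>
      rw [h, Sym2.mem_iff] at hu hw <;> simp only [Set.mem_insert_iff, Set.mem_singleton_iff] <;>
      tauto
  · simp
  · intro u hu w hw huw
    simp only [Set.mem_insert_iff, Set.mem_singleton_iff] at hu hw
    rcases hu with rfl | rfl | rfl <;> rcases hw with rfl | rfl | rfl <;>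
      first | rfl | exact absurd huw (by assumption) | exact absurd huw.symm (by assumption)
  · intro u w z huw hz hm
    rw [hmem u w huw z]
    simp only [Set.mem_insert_iff, Set.mem_singleton_iff] at hz
    rcases hadj u w huw with ⟨h, hs, -⟩ | ⟨h, hs, -⟩ | ⟨h, hs, -⟩ <;>
      rw [h] <;> rw [hs] at hm <;> rcases hz with rfl | rfl | rfl <;>
      first
        | (simp; done)
        | exact absurd (orient_eq_zero_of_mem_segment hm) (by assumption)
  · intro u w u' w' h h' hne
    rcases hadj u w h with ⟨e, -, hs⟩ | ⟨e, -, hs⟩ | ⟨e, -, hs⟩ <;>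
      rcases hadj u' w' h' with ⟨e', -, hs'⟩ | ⟨e', -, hs'⟩ | ⟨e', -, hs'⟩ <;> rw [hs, hs'] <;>
      first
        | exact absurd (e.trans e'.symm) hne
        | assumption
        | exact Disjoint.symm (by assumption)
  · simpa using hφ
  · simp only [List.mem_singleton, forall_eq, Set.mem_insert_iff, Set.mem_singleton_iff,
      forall_eq_or_imp]
    exact ⟨not_inTri_left, not_inTri_mid, not_inTri_right⟩
  · simp only [List.mem_singleton, forall_eq]
    intro u w huw
    rw [Set.disjoint_left]
    intro p hp hin
    rcases hadj u w huw with ⟨-, -, h⟩ | ⟨-, -, h⟩ | ⟨-, -, h⟩ <;> rw [h] at hp <;>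
      have h0 := orient_eq_zero_of_mem_segment (openSegment_subset_segment _ _ _ hp) <;>
      simp only [faceInterior, InTri, Set.mem_ofPred_eq] at hin
    · rcases hin with hin | hin <;> linarith [hin.1]
    · rw [orient_swap] at h0
      rcases hin with hin | hin <;> linarith [hin.2.2]
    · rcases hin with hin | hin <;> linarith [hin.2.1]
  · simp

open Classical in
theorem InnerDrawing.exists_split {L : List (V × V × V × V)} {a b c o d o₁ o₂ o₃ : V}
    (h : InnerDrawing U G ((a, b, c, o) :: L) φ) (hd : d ∉ U) :
    ∃ ψ, InnerDrawing (insert d U) (G ⊔ spokes a b c d)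
      ((a, b, d, o₁) :: (a, c, d, o₂) :: (b, c, d, o₃) :: L) ψ := by
  obtain ⟨x, hx⟩ := exists_inTri (h.orient_ne_zero _ List.mem_cons_self)
  refine ⟨Function.update φ d x, h.split hd (fun u hu => Function.update_of_ne ?_ _ _) ?_⟩
  · rintro rfl; exact hd hu
  · simpa using hx

/-- Keeping `v 0, v 1, v 2` outermost makes every face available for splitting an open triangle free
of vertices and edges, so the next vertex can be put anywhere in it. -/
theorem exists_innerDrawing_stackState {v : ℕ → V} {s : ℕ → ℕ} {N : ℕ}
    (hv : Set.InjOn v (Set.Iio (N + 4))) (hs : ∀ k, s k < 2 * k + 3) {k : ℕ} (hk : k ≤ N) :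
    ∃ φ, InnerDrawing (v '' Set.Iio (k + 4)) (stackState v s k).2 (stackState v s k).1 φ := by
  induction k with
  | zero =>
    have hne : ∀ i < 4, ∀ j < 4, i ≠ j → v i ≠ v j := fun i hi j hj hij h =>
      hij (hv (Set.mem_Iio.2 (by omega)) (Set.mem_Iio.2 (by omega)) h)
    obtain ⟨φ, hφ⟩ := exists_innerDrawing_triangle (hne 0 (by omega) 1 (by omega) (by omega))
      (hne 0 (by omega) 2 (by omega) (by omega)) (hne 1 (by omega) 2 (by omega) (by omega)) (v 3)
    have hU : v '' Set.Iio (0 + 4) = insert (v 3) {v 0, v 1, v 2} := by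
      ext x
      simp only [Set.mem_image, Set.mem_Iio, Set.mem_insert_iff, Set.mem_singleton_iff]
      constructor
      · rintro ⟨i, hi, rfl⟩
        interval_cases i <;> simp
      · rintro (rfl | rfl | rfl | rfl)
        exacts [⟨3, by omega, rfl⟩, ⟨0, by omega, rfl⟩, ⟨1, by omega, rfl⟩, ⟨2, by omega, rfl⟩]
    rw [hU]
    exact hφ.exists_split (by simp [hne])
  | succ k ih =>
    obtain ⟨a, b, c, o, L, -, hp, h⟩ := stackState_succ (v := v) hs k
    obtain ⟨φ, hφ⟩ := ih (by omega)
    have hU : v '' Set.Iio (k + 1 + 4) = insert (v (k + 4)) (v '' Set.Iio (k + 4)) := by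
      rw [← Set.image_insert_eq]
      congr 1
      ext i
      simp only [Set.mem_Iio, Set.mem_insert_iff]
      omega
    rw [hU, h]
    exact (hφ.perm hp).exists_split fun hm => ne_of_mem_image hv hk hm rfl

end InnerDrawing

theorem IsDrawing.isPlanar {V : Type*} {G : SimpleGraph V} {φ : V → Plane} (h : IsDrawing G φ) :
    IsPlanar G := by
  refine ⟨φ, Sym2.lift ⟨fun u w => segment ℝ (φ u) (φ w), fun u w => segment_symm ℝ _ _⟩, h.1,
    ?_, ?_, ?_⟩
  · intro u w huw
    refine ⟨⟨⟨fun t => AffineMap.lineMap (φ u) (φ w) (t : ℝ), by fun_prop⟩, by simp, by simp⟩,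
      ?_, ?_⟩
    · intro t t' htt
      exact Subtype.ext (AffineMap.lineMap_injective ℝ (h.1.ne huw.ne) htt)
    · ext p
      simp only [Sym2.lift_mk, segment_eq_image_lineMap, Set.mem_range, Set.mem_image]
      constructor
      · rintro ⟨t, rfl⟩; exact ⟨t, t.2, rfl⟩
      · rintro ⟨t, ht, rfl⟩; exact ⟨⟨t, ht⟩, rfl⟩
  · intro e
    induction e with
    | _ u w =>
      intro he x hx
      exact Sym2.mem_iff.2 (h.2.1 u w x he hx)
  · intro e
    induction e with
    | _ u w =>
      intro he f
      induction f with
      | _ u' w' =>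
        rintro hf hne x ⟨hx, hx'⟩
        simp only [Sym2.lift_mk] at hx hx'
        have hx0 := hx
        have hx0' := hx'
        rw [← insert_endpoints_openSegment, Set.mem_insert_iff, Set.mem_insert_iff] at hx hx'
        rcases hx with rfl | rfl | hx
        · exact ⟨u, by simp, Sym2.mem_iff.2 (h.2.1 u' w' u hf hx0'), rfl⟩
        · exact ⟨w, by simp, Sym2.mem_iff.2 (h.2.1 u' w' w hf hx0'), rfl⟩
        rcases hx' with rfl | rfl | hx'
        · exact ⟨u', Sym2.mem_iff.2 (h.2.1 u w u' he hx0), by simp, rfl⟩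
        · exact ⟨w', Sym2.mem_iff.2 (h.2.1 u w w' he hx0), by simp, rfl⟩
        · exact absurd hx' (Set.disjoint_left.1 (h.2.2 u w u' w' he hf hne) hx)

/-! ### Counting choice sequences on a point set -/

/-- The choices of faces in the construction of a stacked triangulation with `N + 4` vertices. -/
abbrev StackSeq (N : ℕ) : Type := (i : Fin N) → Fin (2 * i + 3)

namespace StackSeq

variable {N : ℕ}

/-- The choices as a sequence of natural numbers. -/
def toSeq (s : StackSeq N) (k : ℕ) : ℕ := if h : k < N then s ⟨k, h⟩ else 0

theorem toSeq_lt (s : StackSeq N) (k : ℕ) : s.toSeq k < 2 * k + 3 := by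
  unfold toSeq
  split_ifs with h
  · exact (s ⟨k, h⟩).2
  · omega

/-- The stacked triangulation given by a sequence of choices of faces. -/
def graph (s : StackSeq N) : SimpleGraph (Fin (N + 4)) :=
  (stackState (Fin.ofNat (N + 4)) s.toSeq N).2

theorem injOn_ofNat (N : ℕ) : Set.InjOn (Fin.ofNat (N + 4)) (Set.Iio (N + 4)) := by
  intro i hi j hj h
  have := congrArg Fin.val h
  simpa [Fin.ofNat, Nat.mod_eq_of_lt (Set.mem_Iio.1 hi), Nat.mod_eq_of_lt (Set.mem_Iio.1 hj)]
    using this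

theorem isPlanarThreeTree (s : StackSeq N) : IsPlanarThreeTree s.graph := by
  have h := stacked_stackState (injOn_ofNat N) s.toSeq_lt le_rfl
  have hU : (Finset.range (N + 4)).image (Fin.ofNat (N + 4)) = Finset.univ := by
    ext x
    simp only [Finset.mem_univ, Finset.mem_image, Finset.mem_range, iff_true]
    exact ⟨x, x.2, by simp⟩
  rw [hU] at h
  exact ⟨_, h⟩

theorem exists_isDrawing (s : StackSeq N) : ∃ φ, IsDrawing s.graph φ := by
  obtain ⟨φ, hφ⟩ := exists_innerDrawing_stackState (injOn_ofNat N) s.toSeq_lt le_rfl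
  have hU : ∀ x, x ∈ Fin.ofNat (N + 4) '' Set.Iio (N + 4) := fun x => ⟨x, x.2, by simp⟩
  exact ⟨φ, fun x y h => hφ.injOn (hU x) (hU y) h, fun u v w huv => hφ.eq_of_mem u v w huv (hU w),
    hφ.disjoint⟩

theorem isPlanar (s : StackSeq N) : IsPlanar s.graph := by
  obtain ⟨φ, hφ⟩ := s.exists_isDrawing
  exact hφ.isPlanar

theorem eq_of_isDrawing {s t : StackSeq N} {φ : Fin (N + 4) → Plane} (hs : IsDrawing s.graph φ)
    (ht : IsDrawing t.graph φ) : s = t := by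
  ext i
  have := _root_.eq_of_isDrawing (injOn_ofNat N) s.toSeq_lt t.toSeq_lt hs ht i i.2
  simpa [toSeq] using this

/-- Few stacked triangulations can be drawn on a given point set. -/
theorem card_le_of_embeddable (X : Finset Plane) (hX : X.card = N + 4) (E : Finset (StackSeq N))
    (hE : ∀ s ∈ E, StraightLineEmbeddable s.graph X) : E.card ≤ (N + 4).factorial := by
  choose φ hinj hmem hd using hE
  let F : E → (Fin (N + 4) ↪ X) := fun s =>
    ⟨fun i => ⟨φ s.1 s.2 i, hmem s.1 s.2 i⟩, fun i j h => hinj s.1 s.2 (congrArg Subtype.val h)⟩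
  -- A sequence is recovered from its placement, and there are n! placements of n vertices on n
  -- points.
  have hF : Function.Injective F := by
    intro s t hst
    have hφ : φ s.1 s.2 = φ t.1 t.2 := by
      ext1 i
      exact congrArg Subtype.val (DFunLike.congr_fun hst i)
    refine Subtype.ext (eq_of_isDrawing (φ := φ s.1 s.2) ⟨hinj _ _, hd _ _⟩ ?_)
    rw [hφ]
    exact ⟨hinj _ _, hd _ _⟩
  have h := Fintype.card_le_of_injective F hF
  rwa [Fintype.card_coe, Fintype.card_embedding_eq, Fintype.card_coe, Fintype.card_fin, hX,
    Nat.descFactorial_self] at h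

theorem card_stackSeq : Fintype.card (StackSeq N) = ∏ i ∈ Finset.range N, (2 * i + 3) := by
  simp [Fintype.card_pi, Finset.prod_range]

end StackSeq

theorem StraightLineEmbeddable.of_iso {V W : Type*} {G : SimpleGraph V} {H : SimpleGraph W}
    {X : Finset Plane} (h : StraightLineEmbeddable G X) (e : H ≃g G) :
    StraightLineEmbeddable H X := by
  obtain ⟨φ, h1, h2, h3, h4⟩ := h
  refine ⟨φ ∘ e, h1.comp e.injective, fun v => h2 _, fun u v w huv hw => ?_,
    fun u v u' v' huv huv' hne => h4 _ _ _ _ (e.map_adj_iff.2 huv) (e.map_adj_iff.2 huv') ?_⟩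
  · exact (h3 _ _ _ (e.map_adj_iff.2 huv) hw).imp (fun h => e.injective h) fun h => e.injective h
  · intro h
    apply hne
    have : Sym2.map e s(u, v) = Sym2.map e s(u', v') := h
    exact Sym2.map.injective e.injective this

/-! ### Finitely many types of point sets, and the random sample -/

/-- The incidences and crossings among segments between labelled points. -/
abbrev SegmentType (n : ℕ) : Type :=
  Set (Fin n × Fin n × Fin n) × Set (Fin n × Fin n × Fin n × Fin n)

/-- The segment type of a labelled point set. -/
def segmentType {n : ℕ} (p : Fin n → Plane) : SegmentType n :=
  ({i | p i.1 ∈ segment ℝ (p i.2.1) (p i.2.2)},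
    {i | Disjoint (openSegment ℝ (p i.1) (p i.2.1)) (openSegment ℝ (p i.2.2.1) (p i.2.2.2))})

/-- Both conditions of a plane drawing are read off from the segment type, so the drawing is carried
over point by point along the labels. -/
theorem StraightLineEmbeddable.of_segmentType_eq {V : Type*} {G : SimpleGraph V} {n : ℕ}
    {X Y : Finset Plane} {p : Fin n → Plane} {q : Fin n → Plane} (hp : ∀ x ∈ X, ∃ i, p i = x)
    (hq : Function.Injective q) (hqY : ∀ i, q i ∈ Y) (hpq : segmentType p = segmentType q)
    (h : StraightLineEmbeddable G X) : StraightLineEmbeddable G Y := by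
  obtain ⟨φ, h1, h2, h3, h4⟩ := h
  choose f hf using fun v => hp (φ v) (h2 v)
  obtain rfl : p ∘ f = φ := funext hf
  refine ⟨q ∘ f, hq.comp h1.of_comp, fun v => hqY _, fun u v w huv hw => h3 u v w huv ?_,
    fun u v u' v' huv huv' hne => ?_⟩
  · have := congrArg (fun S => (f w, f u, f v) ∈ S.1) hpq
    exact this.mpr hw
  · have := congrArg (fun S => (f u, f v, f u', f v') ∈ S.2) hpq
    exact this.mp (h4 u v u' v' huv huv' hne)

theorem card_segmentType (n : ℕ) :
    Nat.card (SegmentType n) = 2 ^ (n ^ 3 + n ^ 4) := by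
  rw [Nat.card_prod, Nat.card_eq_fintype_card, Nat.card_eq_fintype_card, Fintype.card_set,
    Fintype.card_set, pow_add]
  simp only [Fintype.card_prod, Fintype.card_fin]
  ring_nf

/-- A sample which has few members in each of several small sets, by the union bound. -/
theorem exists_sparse {ι S : Type*} [Fintype ι] [Fintype S] [DecidableEq S] (E : ι → Finset S)
    {g m M : ℕ} (hE : ∀ i, (E i).card ≤ M) (hm : m ≤ g) (hm0 : 0 < m)
    (h : Fintype.card ι * (g ^ m * M ^ m) < Fintype.card S ^ m) :
    ∃ f : Fin g → S, ∀ i, (Finset.univ.filter fun j => f j ∈ E i).card < m := by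
  by_contra hcon
  push Not at hcon
  -- If no sample worked, each would have, for some `i`, a set `A` of `m` positions all landing in
  -- `E i`. There are at most g^m sets `A`, each allowing at most M^m · |S|^(g-m) samples.
  have hcover : (Finset.univ : Finset (Fin g → S)) ⊆ Finset.univ.biUnion fun i : ι =>
      (Finset.powersetCard m (Finset.univ : Finset (Fin g))).biUnion fun A =>
        Fintype.piFinset fun j => if j ∈ A then E i else Finset.univ := by
    intro f _
    obtain ⟨i, hi⟩ := hcon f
    obtain ⟨A, hA, hAm⟩ := Finset.exists_subset_card_eq hi
    simp only [Finset.mem_biUnion, Finset.mem_univ, true_and, Finset.mem_powersetCard]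
    refine ⟨i, A, ⟨Finset.subset_univ _, hAm⟩, Fintype.mem_piFinset.2 fun j => ?_⟩
    split_ifs with hj
    · exact (Finset.mem_filter.1 (hA hj)).2
    · exact Finset.mem_univ _
  have hle := Finset.card_le_card hcover
  have hA : ∀ i, ∀ A ∈ Finset.powersetCard m (Finset.univ : Finset (Fin g)),
      (Fintype.piFinset fun j => if j ∈ A then E i else (Finset.univ : Finset S)).card ≤
        M ^ m * Fintype.card S ^ (g - m) := by
    intro i A hA
    rw [Finset.mem_powersetCard] at hA
    rw [Fintype.card_piFinset]
    simp only [apply_ite Finset.card]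
    rw [Finset.prod_ite, Finset.prod_const, Finset.prod_const, Finset.card_univ]
    have h1 : (Finset.univ.filter fun j => j ∈ A) = A := by ext; simp
    have h2 : (Finset.univ.filter fun j => j ∉ A).card = g - m := by
      rw [Finset.filter_not, h1, Finset.card_sdiff_of_subset hA.1, hA.2]; simp
    rw [h1, h2, hA.2]
    exact Nat.mul_le_mul_right _ (Nat.pow_le_pow_left (hE i) m)
  have hle' : Fintype.card S ^ g ≤
      Fintype.card ι * (g ^ m * (M ^ m * Fintype.card S ^ (g - m))) := by
    calc Fintype.card S ^ g = (Finset.univ : Finset (Fin g → S)).card := by simp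
      _ ≤ _ := hle
      _ ≤ (Finset.univ : Finset ι).card * (g ^ m * (M ^ m * Fintype.card S ^ (g - m))) := by
        refine Finset.card_biUnion_le_card_mul _ _ _ fun i _ => ?_
        refine (Finset.card_biUnion_le_card_mul _ _ _ (hA i)).trans ?_
        rw [Finset.card_powersetCard, Finset.card_univ, Fintype.card_fin]
        exact Nat.mul_le_mul_right _ (Nat.choose_le_pow _ _)
      _ = _ := by simp
  have hpos : 0 < Fintype.card S ^ m := by omega
  have hS : 0 < Fintype.card S ^ (g - m) :=
    Nat.pow_pos (Nat.pos_of_ne_zero fun h0 => by simp [h0, hm0.ne'] at hpos)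
  have hlt := Nat.mul_lt_mul_of_pos_right h hS
  rw [← pow_add, Nat.add_sub_cancel' hm] at hlt
  have : Fintype.card ι * (g ^ m * M ^ m) * Fintype.card S ^ (g - m) =
    Fintype.card ι * (g ^ m * (M ^ m * Fintype.card S ^ (g - m))) := by ring
  omega

open Classical in
/-- There are many pairwise non-isomorphic stacked triangulations such that only few of them can be
drawn on a common point set. -/
theorem exists_sparse_stacked {N g m : ℕ} (hm : (N + 4) ^ 3 + (N + 4) ^ 4 ≤ m)
    (h : 2 * (g * m) * (N + 4).factorial < ∏ i ∈ Finset.range N, (2 * i + 3)) (hg : 0 < g) :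
    ∃ 𝒢 : Finset (SimpleGraph (Fin (N + 4))),
      (∀ G ∈ 𝒢, IsPlanar G ∧ IsPlanarThreeTree G) ∧
      (∀ G ∈ 𝒢, ∀ H ∈ 𝒢, G ≠ H → IsEmpty (G ≃g H)) ∧ g ≤ 𝒢.card ∧
      ∀ 𝒮 ⊆ 𝒢, SimultaneouslyEmbeddable 𝒮 → 𝒮.card < m := by
  -- the sets of choices whose triangulations can be drawn on a point set of a given type
  let E : SegmentType (N + 4) → Finset (StackSeq N) := fun τ =>
    if hτ : ∃ p : Fin (N + 4) → Plane, Function.Injective p ∧ segmentType p = τ then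
      Finset.univ.filter fun s => StraightLineEmbeddable s.graph (Finset.univ.image hτ.choose)
    else ∅
  have hE : ∀ τ, (E τ).card ≤ (N + 4).factorial := by
    intro τ
    by_cases hτ : ∃ p : Fin (N + 4) → Plane, Function.Injective p ∧ segmentType p = τ
    · simp only [E, dif_pos hτ]
      refine StackSeq.card_le_of_embeddable (Finset.univ.image hτ.choose) ?_ _
        fun s hs => (Finset.mem_filter.1 hs).2
      rw [Finset.card_image_of_injective _ hτ.choose_spec.1, Finset.card_univ, Fintype.card_fin]
    · simp [E, dif_neg hτ]
  have hEX : ∀ X : Finset Plane, X.card = N + 4 → ∃ τ, ∀ s : StackSeq N,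
      StraightLineEmbeddable s.graph X → s ∈ E τ := by
    intro X hX
    let e := X.equivFinOfCardEq hX
    have hp : Function.Injective fun i => (e.symm i : Plane) :=
      Subtype.val_injective.comp e.symm.injective
    have hτ : ∃ p : Fin (N + 4) → Plane, Function.Injective p ∧
        segmentType p = segmentType fun i => (e.symm i : Plane) := ⟨_, hp, rfl⟩
    refine ⟨segmentType fun i => (e.symm i : Plane), fun s hs => ?_⟩
    simp only [E, dif_pos hτ, Finset.mem_filter, Finset.mem_univ, true_and]
    exact hs.of_segmentType_eq (p := fun i => (e.symm i : Plane))
      (fun x hx => ⟨e ⟨x, hx⟩, by simp⟩) hτ.choose_spec.1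
      (fun i => Finset.mem_image_of_mem _ (Finset.mem_univ i)) hτ.choose_spec.2.symm
  have hm0 : 0 < m := lt_of_lt_of_le (by positivity) hm
  -- The factor `m` in the sample size pays for isomorphic repetitions: classes of size at most `m`
  -- leave at least `g` of them.
  obtain ⟨f, hf⟩ := exists_sparse E (g := g * m) (m := m) hE (Nat.le_mul_of_pos_left _ hg) hm0 (by
    rw [← Nat.card_eq_fintype_card, card_segmentType, StackSeq.card_stackSeq, ← mul_pow]
    -- By `hm` the number of segment types is at most 2^m, so the union bound costs only a factor 2
    -- per sampled sequence.
    calc _ ≤ 2 ^ m * (g * m * (N + 4).factorial) ^ m :=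
          Nat.mul_le_mul_right _ (Nat.pow_le_pow_right (by omega) hm)
      _ = (2 * (g * m) * (N + 4).factorial) ^ m := by rw [← mul_pow]; ring
      _ < _ := Nat.pow_lt_pow_left h hm0.ne')
  have hfX : ∀ X : Finset Plane, X.card = N + 4 →
      (Finset.univ.filter fun j => StraightLineEmbeddable (f j).graph X).card < m := by
    intro X hX
    obtain ⟨τ, hτ⟩ := hEX X hX
    exact (Finset.card_le_card fun j hj => by
      simp only [Finset.mem_filter, Finset.mem_univ, true_and] at hj ⊢
      exact hτ _ hj).trans_lt (hf τ)
  let r : Setoid (Fin (g * m)) :=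
    { r := fun i j => Nonempty ((f i).graph ≃g (f j).graph)
      iseqv := ⟨fun _ => ⟨SimpleGraph.Iso.refl⟩, fun ⟨e⟩ => ⟨e.symm⟩,
        fun ⟨e⟩ ⟨e'⟩ => ⟨e.trans e'⟩⟩ }
  let c : Quotient r → SimpleGraph (Fin (N + 4)) := fun x => (f x.out).graph
  have hc : ∀ x y, Nonempty (c x ≃g c y) → x = y := fun x y h => by
    rw [← x.out_eq, ← y.out_eq]
    exact Quotient.sound h
  have hcinj : Function.Injective c := fun x y h => hc x y ⟨h ▸ SimpleGraph.Iso.refl⟩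
  refine ⟨Finset.univ.image c, ?_, ?_, ?_, ?_⟩
  · intro G hG
    obtain ⟨x, -, rfl⟩ := Finset.mem_image.1 hG
    exact ⟨StackSeq.isPlanar _, StackSeq.isPlanarThreeTree _⟩
  · intro G hG H hH hne
    obtain ⟨x, -, rfl⟩ := Finset.mem_image.1 hG
    obtain ⟨y, -, rfl⟩ := Finset.mem_image.1 hH
    exact not_nonempty_iff.1 fun h => hne (congrArg c (hc x y h))
  · rw [Finset.card_image_of_injective _ hcinj, Finset.card_univ]
    -- All sampled graphs of one isomorphism class embed in the point set of a single drawing of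
    -- their representative, so sparseness bounds the class.
    have hfib : ∀ x ∈ (Finset.univ : Finset (Quotient r)),
        (Finset.univ.filter fun i : Fin (g * m) => (Quotient.mk r i) = x).card ≤ m := by
      intro x _
      obtain ⟨φ, hφ⟩ := (f x.out).exists_isDrawing
      refine (Finset.card_le_card fun i hi => ?_).trans
        (hfX (Finset.univ.image φ) (by
          rw [Finset.card_image_of_injective _ hφ.1, Finset.card_univ, Fintype.card_fin])).le
      simp only [Finset.mem_filter, Finset.mem_univ, true_and] at hi ⊢
      have hx : StraightLineEmbeddable (f x.out).graph (Finset.univ.image φ) :=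
        ⟨φ, hφ.1, fun v => Finset.mem_image_of_mem _ (Finset.mem_univ v), hφ.2⟩
      obtain ⟨e⟩ : Nonempty ((f i).graph ≃g (f x.out).graph) :=
        Quotient.exact (hi.trans x.out_eq.symm)
      exact hx.of_iso e
    have := Finset.card_le_mul_card_image_of_maps_to
      (s := (Finset.univ : Finset (Fin (g * m)))) (f := Quotient.mk r)
      (fun i _ => Finset.mem_univ _) m hfib
    rw [Finset.card_univ, Fintype.card_fin, Finset.card_univ] at this
    exact Nat.le_of_mul_le_mul_left ((mul_comm m g).le.trans this) hm0
  · rintro 𝒮 h𝒮 ⟨X, hX, hemb⟩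
    have hsub : 𝒮 ⊆ (Finset.univ.filter fun j =>
        StraightLineEmbeddable (f j).graph X).image fun j => (f j).graph := by
      intro G hG
      obtain ⟨x, -, rfl⟩ := Finset.mem_image.1 (h𝒮 hG)
      exact Finset.mem_image.2 ⟨x.out, by simpa using hemb _ hG, rfl⟩
    exact (Finset.card_le_card hsub).trans_lt (Finset.card_image_le.trans_lt (hfX X hX))

/-! ### Numerical estimates -/

/-- The stacked triangulations outnumber the labellings of their vertices exponentially. -/
theorem factorial_lt_prod {n : ℕ} (hn : 238 ≤ n) :
    4 * n ^ 4 * 3 ^ (n - 4) * n.factorial <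
      2 ^ (n - 4) * ∏ i ∈ Finset.range (n - 4), (2 * i + 3) := by
  induction n, hn using Nat.le_induction with
  | base => norm_num [Finset.prod_range_succ, Nat.factorial]
  | succ n hn ih =>
    obtain ⟨k, rfl⟩ : ∃ k, n = k + 4 := ⟨n - 4, by omega⟩
    rw [show k + 4 + 1 - 4 = k + 1 by omega, Finset.prod_range_succ, Nat.factorial_succ]
    rw [show k + 4 - 4 = k by omega] at ih
    -- The growth factor of the left side is about 3k and that of the right side about 4k.
    have hk : 3 * (k + 4 + 1) ^ 5 ≤ (k + 4) ^ 4 * (2 * (2 * k + 3)) := by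
      obtain ⟨j, rfl⟩ : ∃ j, k = j + 234 := ⟨k - 234, by omega⟩
      ring_nf
      gcongr <;> norm_num
    calc 4 * (k + 4 + 1) ^ 4 * 3 ^ (k + 1) * ((k + 4 + 1) * (k + 4).factorial)
        = 3 * (k + 4 + 1) ^ 5 * (4 * 3 ^ k * (k + 4).factorial) := by ring
      _ ≤ (k + 4) ^ 4 * (2 * (2 * k + 3)) * (4 * 3 ^ k * (k + 4).factorial) :=
        Nat.mul_le_mul_right _ hk
      _ = 2 * (2 * k + 3) * (4 * (k + 4) ^ 4 * 3 ^ k * (k + 4).factorial) := by ring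
      _ < 2 * (2 * k + 3) * (2 ^ k * ∏ i ∈ Finset.range k, (2 * i + 3)) :=
        Nat.mul_lt_mul_of_pos_left ih (by positivity)
      _ = _ := by ring

/-- Cleared of denominators, this is 2n⁴ ≤ (3/2)^(n-4): the collection is large enough to contain
2n⁴ graphs. -/
theorem mul_pow_le_pow {n : ℕ} (hn : 238 ≤ n) : 2 * n ^ 4 * 2 ^ (n - 4) ≤ 3 ^ (n - 4) := by
  induction n, hn using Nat.le_induction with
  | base => norm_num
  | succ n hn ih =>
    obtain ⟨k, rfl⟩ : ∃ k, n = k + 4 := ⟨n - 4, by omega⟩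
    rw [show k + 4 + 1 - 4 = k + 1 by omega]
    rw [show k + 4 - 4 = k by omega] at ih
    have hk : 2 * (k + 4 + 1) ^ 4 ≤ 3 * (k + 4) ^ 4 := by
      obtain ⟨j, rfl⟩ : ∃ j, k = j + 234 := ⟨k - 234, by omega⟩
      ring_nf
      gcongr <;> norm_num
    calc 2 * (k + 4 + 1) ^ 4 * 2 ^ (k + 1) = 2 * (k + 4 + 1) ^ 4 * (2 * 2 ^ k) := by ring
      _ ≤ 3 * (k + 4) ^ 4 * (2 * 2 ^ k) := Nat.mul_le_mul_right _ hk
      _ = 3 * (2 * (k + 4) ^ 4 * 2 ^ k) := by ring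
      _ ≤ 3 * 3 ^ k := Nat.mul_le_mul_left _ ih
      _ = 3 ^ (k + 1) := by ring

theorem cube_le_pow {n : ℕ} (hn : 238 ≤ n) : (n : ℝ) ^ 3 ≤ (11 / 10 : ℝ) ^ (n + 37) := by
  induction n, hn using Nat.le_induction with
  | base =>
    rw [show 238 + 37 = 25 * 11 by norm_num, pow_mul]
    norm_num
  | succ n hn ih =>
    have hn' : (238 : ℝ) ≤ n := by exact_mod_cast hn
    have h : ((n : ℝ) + 1) ^ 3 ≤ (11 / 10) * (n : ℝ) ^ 3 := by
      nlinarith [mul_nonneg (sub_nonneg.2 hn') (sq_nonneg (n : ℝ))]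
    calc (((n + 1 : ℕ) : ℝ)) ^ 3 ≤ (11 / 10) * (n : ℝ) ^ 3 := by push_cast; exact h
      _ ≤ (11 / 10) * (11 / 10 : ℝ) ^ (n + 37) := by gcongr
      _ = _ := by ring

/-- The floor loses less than 1 from a power that is at least 2, so more than half of it remains,
well above the factor 1/6. -/
theorem rpow_le_floor {n : ℕ} (hn : 238 ≤ n) :
    (1 / 6 : ℝ) * (7 : ℝ) ^ ((2 * (n : ℝ) - 8) / 11) ≤ ((3 ^ (n - 4) / 2 ^ (n - 4) : ℕ) : ℝ) := by
  obtain ⟨k, rfl⟩ : ∃ k, n = k + 4 := ⟨n - 4, by omega⟩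
  rw [show k + 4 - 4 = k by omega]
  -- Raised to the 11th power, this is 49 ≤ (3/2)^11.
  have h7 : (7 : ℝ) ^ ((2 : ℝ) / 11) ≤ 3 / 2 := by
    refine le_of_pow_le_pow_left₀ (n := 11) (by norm_num) (by norm_num) ?_
    rw [← Real.rpow_natCast, ← Real.rpow_mul (by norm_num)]
    norm_num
  have h1 : (7 : ℝ) ^ ((2 * ((k + 4 : ℕ) : ℝ) - 8) / 11) ≤ (3 / 2 : ℝ) ^ k := by
    have : (2 * ((k + 4 : ℕ) : ℝ) - 8) / 11 = (2 / 11) * (k : ℝ) := by push_cast; ring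
    rw [this, Real.rpow_mul (by norm_num), Real.rpow_natCast]
    gcongr
  have h2 : (3 / 2 : ℝ) ^ k < ((3 ^ k / 2 ^ k : ℕ) : ℝ) + 1 := by
    rw [div_pow, div_lt_iff₀ (by positivity)]
    have := Nat.lt_div_mul_add (a := 3 ^ k) (b := 2 ^ k) (by positivity)
    have h' : ((3 ^ k : ℕ) : ℝ) < ((3 ^ k / 2 ^ k * 2 ^ k + 2 ^ k : ℕ) : ℝ) := by exact_mod_cast this
    push_cast at h' ⊢
    linarith
  have h3 : (2 : ℝ) ≤ (3 / 2 : ℝ) ^ k :=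
    calc (2 : ℝ) ≤ (3 / 2) ^ 2 := by norm_num
      _ ≤ (3 / 2) ^ k := pow_le_pow_right₀ (by norm_num) (by omega)
  linarith

theorem le_mul_rpow {n : ℕ} (hn : 238 ≤ n) :
    ((2 * n ^ 4 : ℕ) : ℝ) ≤ (21 * (n : ℝ) + 552) * (4 : ℝ) ^ (((n : ℝ) + 37) / 11) := by
  -- (11/10)^11 is about 2.85, below 4. The base 11/10 makes the comparison with n³ rational.
  have h4 : (11 / 10 : ℝ) ≤ (4 : ℝ) ^ ((1 : ℝ) / 11) := by
    refine le_of_pow_le_pow_left₀ (n := 11) (by norm_num) (by positivity) ?_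
    rw [← Real.rpow_natCast (_ ^ _), ← Real.rpow_mul (by norm_num)]
    norm_num
  have h1 : (n : ℝ) ^ 3 ≤ (4 : ℝ) ^ (((n : ℝ) + 37) / 11) := by
    have : ((n : ℝ) + 37) / 11 = (1 / 11) * ((n + 37 : ℕ) : ℝ) := by push_cast; ring
    rw [this, Real.rpow_mul (by norm_num), Real.rpow_natCast]
    exact (cube_le_pow hn).trans (by gcongr)
  have hn0 : (0 : ℝ) ≤ n := n.cast_nonneg
  calc ((2 * n ^ 4 : ℕ) : ℝ) = 2 * n * (n : ℝ) ^ 3 := by push_cast; ring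
    _ ≤ (21 * (n : ℝ) + 552) * (n : ℝ) ^ 3 := by gcongr; linarith
    _ ≤ _ := by gcongr

/-! ### The collection and the conflict number -/

theorem exists_collection {n : ℕ} (hn : 238 ≤ n) : ∃ 𝒢 : Finset (SimpleGraph (Fin n)),
    (∀ G ∈ 𝒢, IsPlanar G ∧ IsPlanarThreeTree G) ∧
    (∀ G ∈ 𝒢, ∀ H ∈ 𝒢, G ≠ H → IsEmpty (G ≃g H)) ∧ 3 ^ (n - 4) / 2 ^ (n - 4) ≤ 𝒢.card ∧
    ∀ 𝒮 ⊆ 𝒢, SimultaneouslyEmbeddable 𝒮 → 𝒮.card < 2 * n ^ 4 := by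
  have h1 := factorial_lt_prod hn
  obtain ⟨N, rfl⟩ : ∃ N, n = N + 4 := ⟨n - 4, by omega⟩
  rw [show N + 4 - 4 = N by omega] at *
  refine exists_sparse_stacked ?_ ?_ (Nat.div_pos (Nat.pow_le_pow_left (by omega) N) (by positivity))
  · have : (N + 4) ^ 3 ≤ (N + 4) ^ 4 := Nat.pow_le_pow_right (by omega) (by omega)
    omega
  -- Multiplying by 2^N removes the floor in g = ⌊3^N / 2^N⌋.
  · refine Nat.lt_of_mul_lt_mul_left (a := 2 ^ N) (lt_of_le_of_lt ?_ h1)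
    calc 2 ^ N * (2 * (3 ^ N / 2 ^ N * (2 * (N + 4) ^ 4)) * (N + 4).factorial)
        = 4 * (N + 4) ^ 4 * (3 ^ N / 2 ^ N * 2 ^ N) * (N + 4).factorial := by ring
      _ ≤ _ := by gcongr; exact Nat.div_mul_le_self _ _

/-- Any 2n⁴ members of the collection already conflict, since embeddable subcollections are strictly
smaller; the bound obtained is polynomial. -/
theorem conflictNumber_le {n : ℕ} (hn : 238 ≤ n) : conflictNumber n ≤ ((2 * n ^ 4 : ℕ) : ℕ∞) := by
  obtain ⟨𝒢, h1, -, h3, h4⟩ := exists_collection hn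
  have h5 : 2 * n ^ 4 ≤ 𝒢.card :=
    ((Nat.le_div_iff_mul_le (by positivity)).2 (mul_pow_le_pow hn)).trans h3
  obtain ⟨𝒮, hs, hcard⟩ := Finset.exists_subset_card_eq h5
  rw [← hcard]
  exact iInf₂_le 𝒮 ⟨fun G hG => (h1 G (hs hG)).1, fun hemb => (h4 𝒮 hs hemb).ne hcard⟩

theorem theorem1 :
    (∀ n : ℕ, 238 ≤ n → ∃ 𝒢 : Finset (SimpleGraph (Fin n)),
      (∀ G ∈ 𝒢, IsPlanar G ∧ IsPlanarThreeTree G) ∧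
      (∀ G ∈ 𝒢, ∀ H ∈ 𝒢, G ≠ H → IsEmpty (G ≃g H)) ∧
      (1 / 6 : ℝ) * (7 : ℝ) ^ ((2 * (n : ℝ) - 8) / 11) ≤ (𝒢.card : ℝ) ∧
      (∀ 𝒮 : Finset (SimpleGraph (Fin n)), 𝒮 ⊆ 𝒢 → SimultaneouslyEmbeddable 𝒮 →
        (𝒮.card : ℝ) ≤ (21 * (n : ℝ) + 552) * (4 : ℝ) ^ (((n : ℝ) + 37) / 11))) ∧
    (∀ n : ℕ, 238 ≤ n → conflictNumber n ≠ ⊤) ∧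
    Asymptotics.IsBigO Filter.atTop
      (fun n : ℕ => ((conflictNumber n).toNat : ℝ))
      (fun n : ℕ => (n : ℝ) * (4 : ℝ) ^ ((n : ℝ) / 11)) := by
  refine ⟨fun n hn => ?_, fun n hn => ?_, ?_⟩
  · obtain ⟨𝒢, h1, h2, h3, h4⟩ := exists_collection hn
    refine ⟨𝒢, h1, h2, (rpow_le_floor hn).trans (by exact_mod_cast h3), fun 𝒮 hs hemb => ?_⟩
    exact le_trans (by exact_mod_cast (h4 𝒮 hs hemb).le) (le_mul_rpow hn)
  · exact ne_top_of_le_ne_top (ENat.natCast_ne_top _) (conflictNumber_le hn)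
  -- 573 = 21 + 552 absorbs the constant term using n ≥ 1, and 4^(37/11) is split off from the
  -- exponent.
  · refine Asymptotics.IsBigO.of_bound (573 * (4 : ℝ) ^ ((37 : ℝ) / 11)) ?_
    filter_upwards [Filter.eventually_ge_atTop 238] with n hn
    have h1 : (conflictNumber n).toNat ≤ 2 * n ^ 4 :=
      ENat.toNat_le_of_le_natCast (conflictNumber_le hn)
    have h2 : ((conflictNumber n).toNat : ℝ) ≤ ((2 * n ^ 4 : ℕ) : ℝ) := by exact_mod_cast h1
    have hn' : (1 : ℝ) ≤ n := by exact_mod_cast (show 1 ≤ n by omega)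
    rw [Real.norm_of_nonneg (by positivity), Real.norm_of_nonneg (by positivity)]
    calc _ ≤ (21 * (n : ℝ) + 552) * (4 : ℝ) ^ (((n : ℝ) + 37) / 11) := h2.trans (le_mul_rpow hn)
      _ ≤ (573 * (n : ℝ)) * (4 : ℝ) ^ (((n : ℝ) + 37) / 11) := by gcongr; linarith
      _ = _ := by
        rw [add_div, Real.rpow_add (by norm_num)]
        ring
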